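/- Let $l\approx 0.0945$ be the unique root in $(0,\tfrac14)$ of $\ln(1-2l)-\ln l-3+9l=0$, let $r=1-2l$, and define $\lambda:[0,1]\to\mathbb R$ by $$\lambda(x)=\begin{cases}(1-2x)^2,&0\le x<l,\\ lr^2/x,&l\le x<r,\\ \tfrac12x(1-x),&r\le x\le 1.\end{cases}$$ Let $C:[0,1]\to\mathbb R$ be continuously differentiable (with one-sided derivatives at the end points) and such that $t\mapsto tC'(t)$ is strictly increasing on $[0,1]$. A dual solution for the cost $c(x,y,z)=C(xyz)$ on $[0,1]^3$ with Lebesgue marginals is a triple of Lebesgue integrable functions $f,g,h:[0,1]\to\mathbb R$ with $f(x)+g(y)+h(z)\le C(xyz)$ for all $x,y,z\in[0,1]$ which maximizes $\int_0^1 f\,dx+\int_0^1 g\,dx+\int_0^1 h\,dx$ among all such triples. Put $\hat f(s)=\int_0^s\lambda(t)C'(t\lambda(t))\,dt$. Then a triple $(f,g,h)$ of functions $[0,1]\to\mathbb R$ is a dual solution if and only if there exist constants $C_f,C_g,C_h\in\mathbb R$ with $$C_f+C_g+C_h=C(0)-2\int_0^1\lambda(t)C'(t\lambda(t))\,dt$$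 such that for all $x,y,z\in[0,1]$ $$f(x)\le\hat f(x)+C_f,\qquad g(y)\le\hat f(y)+C_g,\qquad h(z)\le\hat f(z)+C_h,$$ with equality almost everywhere in each of the three inequalities. Consequently the dual solution is unique up to additive constants and null sets: if $(f,g,h)$ and $(f',g',h')$ are dual solutions, there are constants $a,b,c$ with $a+b+c=0$ such that $f'=f+a$, $g'=g+b$, $h'=h+c$ almost everywhere. -/

import Mathlib

open MeasureTheory Set

noncomputable section

namespace MultimarginalXYZ

/-! ### The dual problem with three marginals -/

section Dual

variable {X Y Z : Type*} [MeasurableSpace X] [MeasurableSpace Y] [MeasurableSpace Z]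

/-- A triple of integrable functions with `f(x) + g(y) + h(z) ≤ c(x, y, z)` at every point. -/
def IsDualFeasible (μ : Measure X) (ν : Measure Y) (ρ : Measure Z) (c : X → Y → Z → ℝ)
    (f : X → ℝ) (g : Y → ℝ) (h : Z → ℝ) : Prop :=
  Integrable f μ ∧ Integrable g ν ∧ Integrable h ρ ∧ ∀ x y z, f x + g y + h z ≤ c x y z

/-- The functional that is maximized in the dual problem. -/
def dualValue (μ : Measure X) (ν : Measure Y) (ρ : Measure Z)
    (f : X → ℝ) (g : Y → ℝ) (h : Z → ℝ) : ℝ :=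
  ∫ x, f x ∂μ + ∫ y, g y ∂ν + ∫ z, h z ∂ρ

/-- A dual solution: a feasible triple at which the dual functional attains its maximum over all
feasible triples. -/
def IsDualSolution (μ : Measure X) (ν : Measure Y) (ρ : Measure Z) (c : X → Y → Z → ℝ)
    (f : X → ℝ) (g : Y → ℝ) (h : Z → ℝ) : Prop :=
  IsDualFeasible μ ν ρ c f g h ∧
    ∀ (f' : X → ℝ) (g' : Y → ℝ) (h' : Z → ℝ), IsDualFeasible μ ν ρ c f' g' h' →
      dualValue μ ν ρ f' g' h' ≤ dualValue μ ν ρ f g h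

end Dual

/-! ### The constants `l`, `r` and the function `λ` -/

lemma hasDerivAt_aux {x : ℝ} (h0 : 0 < x) (h1 : x < 1 / 2) :
    HasDerivAt (fun x : ℝ => Real.log (1 - 2 * x) - Real.log x - 3 + 9 * x)
      (-(3 * x - 1) * (6 * x - 1) / (x * (1 - 2 * x))) x := by
  have hx : 1 - 2 * x ≠ 0 := by linarith
  have e1 : HasDerivAt (fun x : ℝ => 1 - 2 * x) (-(2 * 1)) x :=
    ((hasDerivAt_id x).const_mul (2 : ℝ)).const_sub 1
  have e2 : HasDerivAt (fun x : ℝ => 9 * x) (9 * 1) x := (hasDerivAt_id x).const_mul (9 : ℝ)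
  refine ((((e1.log hx).sub (Real.hasDerivAt_log h0.ne')).sub_const 3).add e2).congr_deriv ?_
  have := h0.ne'
  field_simp
  ring

/-- The equation `ln(1 - 2l) - ln l - 3 + 9l = 0` has exactly one root in `(0, 1/4)`. -/
lemma existsUnique_root : ∃! l : ℝ, (0 < l ∧ l < 1 / 4) ∧
    Real.log (1 - 2 * l) - Real.log l - 3 + 9 * l = 0 := by
  set F : ℝ → ℝ := fun x => Real.log (1 - 2 * x) - Real.log x - 3 + 9 * x with hF
  have hc : ∀ a b : ℝ, 0 < a → b < 1 / 2 → ContinuousOn F (Icc a b) := fun a b ha hb x hx =>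
    (hasDerivAt_aux (lt_of_lt_of_le ha hx.1) (lt_of_le_of_lt hx.2 hb)).continuousAt.continuousWithinAt
  have hanti : ∀ a b : ℝ, 0 < a → a < b → b ≤ 1 / 6 → F b < F a := by
    intro a b ha hab hb
    refine strictAntiOn_of_deriv_neg (convex_Icc a b) (hc a b ha (by linarith)) ?_
      ⟨le_rfl, hab.le⟩ ⟨hab.le, le_rfl⟩ hab
    intro x hx
    rw [interior_Icc] at hx
    have h0 : 0 < x := ha.trans hx.1
    have h1 : x < 1 / 6 := hx.2.trans_le hb
    rw [(hasDerivAt_aux h0 (by linarith)).deriv]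
    refine div_neg_of_neg_of_pos ?_ (mul_pos h0 (by linarith))
    nlinarith
  have hmono : ∀ a : ℝ, 1 / 6 ≤ a → a < 1 / 4 → F a < 0 := by
    intro a ha hb
    have h3 : F (1 / 3) = 0 := by simp only [hF]; norm_num
    rw [← h3]
    refine strictMonoOn_of_deriv_pos (convex_Icc a (1 / 3))
      (hc a (1 / 3) (by linarith) (by norm_num)) ?_
      ⟨le_rfl, by linarith⟩ ⟨by linarith, le_rfl⟩ (by linarith)
    intro x hx
    rw [interior_Icc] at hx
    have h0 : 1 / 6 < x := ha.trans_lt hx.1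
    have h1 : x < 1 / 3 := hx.2
    rw [(hasDerivAt_aux (by linarith) (by linarith)).deriv]
    refine div_pos ?_ (mul_pos (by linarith) (by linarith))
    nlinarith
  have h20 : 0 ≤ F (1 / 20) := by
    have : Real.log (1 - 2 * (1 / 20)) - Real.log (1 / 20) = Real.log 18 := by
      rw [← Real.log_div (by norm_num) (by norm_num)]; norm_num
    have h18 : Real.log 16 ≤ Real.log 18 := Real.log_le_log (by norm_num) (by norm_num)
    have h16 : Real.log 16 = 4 * Real.log 2 := by
      rw [show (16 : ℝ) = 2 ^ 4 by norm_num, Real.log_pow]; norm_num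
    have := Real.log_two_gt_d9
    simp only [hF]
    linarith
  have h6 : F (1 / 6) < 0 := hmono _ le_rfl (by norm_num)
  obtain ⟨l, hl, hl0⟩ := intermediate_value_Icc' (by norm_num : (1 / 20 : ℝ) ≤ 1 / 6)
    (hc _ _ (by norm_num) (by norm_num)) ⟨h6.le, h20⟩
  have hl6 : ∀ y : ℝ, y < 1 / 4 → F y = 0 → y < 1 / 6 := by
    intro y hy hy0
    by_contra hcon
    exact absurd hy0 (hmono y (not_lt.mp hcon) hy).ne
  refine ⟨l, ⟨⟨by linarith [hl.1], by linarith [hl.2]⟩, hl0⟩, ?_⟩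
  rintro y ⟨⟨hy, hy4⟩, hy0⟩
  have hy6 := hl6 y hy4 hy0
  rcases lt_trichotomy y l with h | h | h
  · have := hanti y l hy h hl.2
    rw [hl0] at this
    exact absurd hy0 this.ne'
  · exact h
  · have := hanti l y (by linarith [hl.1]) h hy6.le
    rw [hl0] at this
    exact absurd hy0 this.ne

/-- The unique root in `(0, 1/4)` of `ln(1 - 2l) - ln l - 3 + 9l = 0`. -/
def l : ℝ := existsUnique_root.choose

/-- The constant `r = 1 - 2l`. -/
def r : ℝ := 1 - 2 * l

/-- The function `λ`, used only on `[0, 1]`. -/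
def lam (x : ℝ) : ℝ :=
  if x < l then (1 - 2 * x) ^ 2 else if x < r then l * r ^ 2 / x else x * (1 - x) / 2

/-- `f̂(s) = ∫₀ˢ λ(t) C'(t λ(t)) dt`, where `C'` is the derivative of `C` on `[0, 1]`
(one-sided at the end points). -/
def fHat (C : ℝ → ℝ) (s : ℝ) : ℝ :=
  ∫ t in (0 : ℝ)..s, lam t * derivWithin C (Icc 0 1) (t * lam t)

/-- `(f, g, h)` is a dual solution for the cost `C(xyz)` on `[0, 1]³`, all three marginals being
Lebesgue measure on `[0, 1]`. -/
def IsDualSolutionXYZ (C : ℝ → ℝ) (f g h : unitInterval → ℝ) : Prop :=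
  IsDualSolution (volume : Measure unitInterval) (volume : Measure unitInterval)
    (volume : Measure unitInterval) (fun x y z => C ((x : ℝ) * (y : ℝ) * (z : ℝ))) f g h

end MultimarginalXYZ

end

namespace MultimarginalXYZ

/-! ### Elementary properties of `l`, `r` and `lam` -/

/-! Put U(t) = t C'(t). Since U is increasing, C is a convex function of log t. The proof rests on a
coupling π of three uniform variables concentrated on `OnSupport`, where yz = λ(x), and cyclically.
Potentials that are tight there must satisfy f'(x) = λ(x) C'(xλ(x)), which dictates the candidate
`potential`.

Feasibility (`potential_add_le`): as a function of log t the potential has slope U(tλ(t)), and tλ(t)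
rises on [0, l], is constant on [l, r] and falls on [r, 1]. If x is the smallest coordinate and a =
min(x, l), the three potentials lie below log-affine functions of common slope U(a(1-2a)²) through
their values at the contact point (a, 1-2a, 1-2a), while C lies above its log-tangent of the same
slope. Equality on the support is `OnSupport.potential_add_eq`.

Existence of π (`exists_isOptimalCoupling`): one arm accounts for [0, l] and [r, 1]. On the central
piece, logarithmic coordinates turn xyz = lr² into s₁ + s₂ + s₃ = 0, and an explicit measure on this
plane has the required sum of marginals. The equation defining l says that this target has mean
zero, which is necessary on such a plane.

Uniqueness: integrating against π shows that the candidate is optimal and that every optimal triple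
is tight π-almost everywhere. Conjugation replaces the functions of an optimal triple by larger
continuous ones that agree with them almost everywhere. By compactness every point of [0, 1] then
occurs in a tight triple with yz = λ(x). This squeezes the difference quotients and determines the
derivative (`eq_potential_add_const`). -/

lemma l_spec : (0 < l ∧ l < 1 / 4) ∧ Real.log (1 - 2 * l) - Real.log l - 3 + 9 * l = 0 :=
  existsUnique_root.choose_spec.1

lemma l_pos : 0 < l := l_spec.1.1

/-- The defining function increases on [1/6, 1/3] and vanishes at the spurious root 1/3, so it is
negative on [1/6, 1/4). The bound matters because a(1-2a)² has its critical point at 1/6. -/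
lemma l_lt_sixth : l < 1 / 6 := by
  set G : ℝ → ℝ := fun x => Real.log (1 - 2 * x) - Real.log x - 3 + 9 * x with hG
  by_contra! hl
  have h3 : G (1 / 3) = 0 := by simp only [hG]; norm_num
  have h4 := l_spec.1.2
  have : G l < G (1 / 3) := by
    refine strictMonoOn_of_deriv_pos (convex_Icc l (1 / 3)) (fun x hx => ?_) ?_
      ⟨le_rfl, by linarith⟩ ⟨by linarith, le_rfl⟩ (by linarith)
    · exact (hasDerivAt_aux (by linarith [hx.1]) (by linarith [hx.2])).continuousAt
        |>.continuousWithinAt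
    · intro x hx
      rw [interior_Icc] at hx
      have h0 : 1 / 6 < x := hl.trans_lt hx.1
      have h1 : x < 1 / 3 := hx.2
      rw [(hasDerivAt_aux (by linarith) (by linarith)).deriv]
      refine div_pos ?_ (mul_pos (by linarith) (by linarith))
      nlinarith
  rw [h3] at this
  exact this.ne l_spec.2

lemma r_eq : r = 1 - 2 * l := rfl

lemma r_pos : 0 < r := by linarith [r_eq, l_lt_sixth]

lemma two_thirds_lt_r : 2 / 3 < r := by linarith [r_eq, l_lt_sixth]

lemma l_lt_r : l < r := by linarith [two_thirds_lt_r, l_lt_sixth]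

lemma r_lt_one : r < 1 := by linarith [r_eq, l_pos]

lemma lam_of_le {x : ℝ} (h : x ≤ l) : lam x = (1 - 2 * x) ^ 2 := by
  rcases h.lt_or_eq with h | rfl
  · simp [lam, h]
  · have := l_pos.ne'
    simp only [lam, lt_irrefl, if_false, l_lt_r, if_true]
    rw [← r_eq]
    field_simp

lemma lam_of_mem {x : ℝ} (h : x ∈ Icc l r) : lam x = l * r ^ 2 / x := by
  rcases h.2.lt_or_eq with h' | h'
  · simp [lam, h', not_lt.2 h.1]
  · subst h'
    have := r_pos.ne'
    simp only [lam, not_lt.2 l_lt_r.le, lt_irrefl, if_false]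
    field_simp
    linarith [r_eq]

lemma lam_of_ge {x : ℝ} (h : r ≤ x) : lam x = x * (1 - x) / 2 := by
  simp [lam, not_lt.2 h, not_lt.2 (l_lt_r.le.trans h)]

lemma continuous_lam : Continuous lam := by
  have h1 : ContinuousOn lam (Iic l) :=
    (by fun_prop : Continuous fun x : ℝ => (1 - 2 * x) ^ 2).continuousOn.congr
      fun x hx => lam_of_le hx
  have h2 : ContinuousOn lam (Icc l r) := by
    refine ContinuousOn.congr (f := fun x => l * r ^ 2 / x) ?_ fun x hx => lam_of_mem hx
    exact continuousOn_const.div continuousOn_id fun x hx => (l_pos.trans_le hx.1).ne'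
  have h3 : ContinuousOn lam (Ici r) :=
    (by fun_prop : Continuous fun x : ℝ => x * (1 - x) / 2).continuousOn.congr
      fun x hx => lam_of_ge hx
  have h12 := h1.union_of_isClosed h2 isClosed_Iic isClosed_Icc
  have h123 := h12.union_of_isClosed h3 (isClosed_Iic.union isClosed_Icc) isClosed_Ici
  rw [Iic_union_Icc_eq_Iic l_lt_r.le, Iic_union_Ici] at h123
  exact continuousOn_univ.1 h123

lemma lam_nonneg {x : ℝ} (hx : x ∈ Icc (0 : ℝ) 1) : 0 ≤ lam x := by
  rcases le_total x l with h | h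
  · rw [lam_of_le h]; positivity
  rcases le_total x r with h' | h'
  · rw [lam_of_mem ⟨h, h'⟩]
    have := l_pos
    have := hx.1
    positivity
  · rw [lam_of_ge h']
    have := mul_nonneg hx.1 (sub_nonneg.2 hx.2)
    linarith

/-- On `[0, 1/6]` the function `a (1 - 2a)²` is monotone. -/
lemma mul_sq_le_mul_sq {a b : ℝ} (ha : 0 ≤ a) (hab : a ≤ b) (hb : b ≤ 1 / 6) :
    a * (1 - 2 * a) ^ 2 ≤ b * (1 - 2 * b) ^ 2 := by
  have key : b * (1 - 2 * b) ^ 2 - a * (1 - 2 * a) ^ 2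
      = (b - a) * ((1 - 2 * (a + b)) ^ 2 - 4 * a * b) := by ring
  have h1 : 4 * a * b ≤ (1 / 3) * (1 / 3) := by nlinarith
  have h2 : (1 / 3) * (1 / 3) ≤ (1 - 2 * (a + b)) ^ 2 := by nlinarith
  have := mul_nonneg (sub_nonneg.2 hab) (by linarith : 0 ≤ (1 - 2 * (a + b)) ^ 2 - 4 * a * b)
  linarith

lemma mul_lam_of_le {x : ℝ} (h : x ≤ l) : x * lam x = x * (1 - 2 * x) ^ 2 := by
  rw [lam_of_le h]

lemma mul_lam_of_mem {x : ℝ} (h : x ∈ Icc l r) : x * lam x = l * r ^ 2 := by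
  have := (l_pos.trans_le h.1).ne'
  rw [lam_of_mem h]
  field_simp

/-- With a = (1 - x)/2 the product takes the same form a(1-2a)² as on the left branch, so one
monotone function governs both ends. -/
lemma mul_lam_of_ge {x : ℝ} (h : r ≤ x) :
    x * lam x = (1 - x) / 2 * (1 - 2 * ((1 - x) / 2)) ^ 2 := by
  rw [lam_of_ge h]; ring

lemma lam_one_sub {a : ℝ} (h : a ≤ l) : lam (1 - 2 * a) = a * (1 - 2 * a) := by
  rw [lam_of_ge (by linarith [r_eq])]; ring

/-- Unimodality of tλ(t), whose values at a and at 1-2a coincide: it is at least this common value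
between the two points. -/
lemma mul_sq_le_mul_lam {a t : ℝ} (ha : 0 ≤ a) (hal : a ≤ l) (h1 : a ≤ t) (h2 : t ≤ 1 - 2 * a) :
    a * (1 - 2 * a) ^ 2 ≤ t * lam t := by
  have hl := l_lt_sixth.le
  rcases le_total t l with h | h
  · rw [mul_lam_of_le h]
    exact mul_sq_le_mul_sq ha h1 (by linarith)
  rcases le_total t r with h' | h'
  · rw [mul_lam_of_mem ⟨h, h'⟩, r_eq]
    exact mul_sq_le_mul_sq ha hal hl
  · rw [mul_lam_of_ge h']
    exact mul_sq_le_mul_sq ha (by linarith) (by linarith [r_eq])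

lemma mul_lam_le_mul_sq {a t : ℝ} (hal : a ≤ l) (h1 : 1 - 2 * a ≤ t) (h2 : t ≤ 1) :
    t * lam t ≤ a * (1 - 2 * a) ^ 2 := by
  have hl := l_lt_sixth.le
  rw [mul_lam_of_ge (by linarith [r_eq])]
  exact mul_sq_le_mul_sq (by linarith) (by linarith) (by linarith)

lemma mul_lam_le {t : ℝ} (h : t ∈ Icc (0 : ℝ) 1) : t * lam t ≤ l * r ^ 2 := by
  have hl := l_lt_sixth.le
  rcases le_total t l with h1 | h1
  · rw [mul_lam_of_le h1]
    exact mul_sq_le_mul_sq h.1 h1 hl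
  rcases le_total t r with h' | h'
  · exact (mul_lam_of_mem ⟨h1, h'⟩).le
  · exact mul_lam_le_mul_sq le_rfl h' h.2

lemma mul_lam_mem {t : ℝ} (h : t ∈ Icc (0 : ℝ) 1) : t * lam t ∈ Icc (0 : ℝ) 1 := by
  refine ⟨mul_nonneg h.1 (lam_nonneg h), (mul_lam_le h).trans ?_⟩
  have h1 : r ^ 2 ≤ 1 := pow_le_one₀ r_pos.le r_lt_one.le
  have := l_lt_sixth
  nlinarith [l_pos, sq_nonneg r]

lemma lam_le_one {t : ℝ} (h : t ∈ Icc (0 : ℝ) 1) : lam t ≤ 1 := by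
  rcases le_total t l with h1 | h1
  · rw [lam_of_le h1]
    have := l_lt_sixth
    nlinarith [h.1]
  rcases le_total t r with h' | h'
  · rw [lam_of_mem ⟨h1, h'⟩, div_le_one (l_pos.trans_le h1)]
    have : r ^ 2 ≤ 1 := pow_le_one₀ r_pos.le r_lt_one.le
    nlinarith [l_pos]
  · rw [lam_of_ge h']
    nlinarith [h.1, h.2]

/-! ### The set on which the optimal plan is concentrated -/

/-- The union of the three arms through `(a, 1 - 2a, 1 - 2a)`, `0 ≤ a ≤ l`, and of the central
piece `{xyz = l r²} ∩ [l, r]³`. -/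
def OnSupport (x y z : ℝ) : Prop :=
  (∃ a ∈ Icc 0 l, (x = a ∧ y = 1 - 2 * a ∧ z = 1 - 2 * a) ∨
    (x = 1 - 2 * a ∧ y = a ∧ z = 1 - 2 * a) ∨ (x = 1 - 2 * a ∧ y = 1 - 2 * a ∧ z = a)) ∨
  (x ∈ Icc l r ∧ y ∈ Icc l r ∧ z ∈ Icc l r ∧ x * y * z = l * r ^ 2)

lemma OnSupport.rotate {x y z : ℝ} (h : OnSupport x y z) : OnSupport y z x := by
  rcases h with ⟨a, ha, h⟩ | ⟨h1, h2, h3, h4⟩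
  · exact Or.inl ⟨a, ha, by tauto⟩
  · exact Or.inr ⟨h2, h3, h1, by rw [← h4]; ring⟩

lemma OnSupport.mul_eq_lam {x y z : ℝ} (h : OnSupport x y z) : y * z = lam x := by
  rcases h with ⟨a, ha, ⟨rfl, rfl, rfl⟩ | ⟨rfl, rfl, rfl⟩ | ⟨rfl, rfl, rfl⟩⟩ | ⟨h1, h2, h3, h4⟩
  · rw [lam_of_le ha.2]; ring
  · rw [lam_one_sub ha.2]
  · rw [lam_one_sub ha.2]; ring
  · rw [lam_of_mem h1, ← h4]
    have := (l_pos.trans_le h1.1).ne'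
    field_simp

/-! ### The candidate potential -/

/-- The potential `∫₀ˢ λ(t) k(t λ(t)) dt` for a function `k` on the whole line. -/
noncomputable def potential (k : ℝ → ℝ) (s : ℝ) : ℝ := ∫ t in (0 : ℝ)..s, lam t * k (t * lam t)

lemma hasDerivAt_potential {k : ℝ → ℝ} (hk : Continuous k) (s : ℝ) :
    HasDerivAt (potential k) (lam s * k (s * lam s)) s := by
  have hc : Continuous fun t => lam t * k (t * lam t) :=
    continuous_lam.mul (hk.comp (continuous_id.mul continuous_lam))
  exact intervalIntegral.integral_hasDerivAt_right (hc.intervalIntegrable _ _)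
    (hc.stronglyMeasurableAtFilter _ _) hc.continuousAt

lemma potential_zero (k : ℝ → ℝ) : potential k 0 = 0 := by simp [potential]

lemma continuous_potential {k : ℝ → ℝ} (hk : Continuous k) : Continuous (potential k) :=
  continuous_iff_continuousAt.2 fun s => (hasDerivAt_potential hk s).continuousAt

lemma mul_log_le_sub {F F' : ℝ → ℝ} {c a b : ℝ} (ha : 0 < a) (hab : a ≤ b)
    (hF : ∀ t ∈ Icc a b, HasDerivAt F (F' t) t) (hc : ∀ t ∈ Icc a b, c ≤ t * F' t) :
    c * (Real.log b - Real.log a) ≤ F b - F a := by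
  have hd : ∀ t ∈ Icc a b, HasDerivAt (fun t => F t - c * Real.log t) (F' t - c * t⁻¹) t :=
    fun t ht => (hF t ht).sub ((Real.hasDerivAt_log (ha.trans_le ht.1).ne').const_mul c)
  have hm : MonotoneOn (fun t => F t - c * Real.log t) (Icc a b) := by
    refine monotoneOn_of_deriv_nonneg (convex_Icc a b)
      (fun t ht => (hd t ht).continuousAt.continuousWithinAt)
      (fun t ht => (hd t (interior_subset ht)).differentiableAt.differentiableWithinAt)
      fun t ht => ?_
    have ht := interior_subset ht
    have h0 : 0 < t := ha.trans_le ht.1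
    rw [(hd t ht).deriv]
    have := hc t ht
    rw [sub_nonneg, ← div_eq_mul_inv, div_le_iff₀ h0]
    linarith
  have := hm (left_mem_Icc.2 hab) (right_mem_Icc.2 hab) hab
  simp only at this
  linarith

lemma sub_le_mul_log {F F' : ℝ → ℝ} {c a b : ℝ} (ha : 0 < a) (hab : a ≤ b)
    (hF : ∀ t ∈ Icc a b, HasDerivAt F (F' t) t) (hc : ∀ t ∈ Icc a b, t * F' t ≤ c) :
    F b - F a ≤ c * (Real.log b - Real.log a) := by
  have := mul_log_le_sub (F := fun t => -F t) (F' := fun t => -F' t) (c := -c) ha hab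
    (fun t ht => (hF t ht).neg) (fun t ht => by linarith [hc t ht])
  linarith

/-! ### Feasibility of the potentials and equality on the support -/

section Potential

variable {C k : ℝ → ℝ}

/-- The tangent bound for `C` as a function of `log t`. -/
lemma add_mul_log_le (hC : ∀ t, HasDerivAt C (k t) t)
    (hU : MonotoneOn (fun t => t * k t) (Icc 0 1)) {θ s : ℝ} (hθ : 0 < θ) (hθ1 : θ ≤ 1)
    (hs : 0 < s) (hs1 : s ≤ 1) :
    C θ + θ * k θ * (Real.log s - Real.log θ) ≤ C s := by
  rcases le_total θ s with h | h
  · have := mul_log_le_sub (c := θ * k θ) hθ h (fun t _ => hC t) fun t ht =>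
      hU ⟨hθ.le, hθ1⟩ ⟨hθ.le.trans ht.1, ht.2.trans hs1⟩ ht.1
    linarith
  · have := sub_le_mul_log (c := θ * k θ) hs h (fun t _ => hC t) fun t ht =>
      hU ⟨hs.le.trans ht.1, ht.2.trans hθ1⟩ ⟨hθ.le, hθ1⟩ ht.2
    linarith

/-- Along the arm all three derivatives evaluate k at the same point θ = a(1-2a)², so the derivative
of left minus right is k(θ)((1-2a)² - 4a(1-2a) - θ'(a)) = 0. The constant is read off at a = 0. -/
lemma potential_arm (hk : Continuous k) (hC : ∀ t, HasDerivAt C (k t) t) {a : ℝ}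
    (ha : a ∈ Icc 0 l) :
    potential k a + 2 * potential k (1 - 2 * a)
      = C (a * (1 - 2 * a) ^ 2) - C 0 + 2 * potential k 1 := by
  set G : ℝ → ℝ := fun a => potential k a + 2 * potential k (1 - 2 * a) - C (a * (1 - 2 * a) ^ 2)
  have hG : ∀ a ∈ Icc 0 l, HasDerivAt G 0 a := by
    intro a ha
    have e1 : HasDerivAt (fun a : ℝ => 1 - 2 * a) (-(2 * 1)) a :=
      ((hasDerivAt_id a).const_mul (2 : ℝ)).const_sub 1
    have e2 : HasDerivAt (fun a : ℝ => a * (1 - 2 * a) ^ 2)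
        (1 * (1 - 2 * a) ^ 2 + a * ((2 : ℕ) * (1 - 2 * a) ^ (2 - 1) * (-(2 * 1)))) a :=
      (hasDerivAt_id a).mul (e1.pow 2)
    refine (((hasDerivAt_potential hk a).add
      (((hasDerivAt_potential hk (1 - 2 * a)).comp a e1).const_mul 2)).sub
      ((hC _).comp a e2)).congr_deriv ?_
    rw [lam_one_sub ha.2, lam_of_le ha.2,
      show (1 - 2 * a) * (a * (1 - 2 * a)) = a * (1 - 2 * a) ^ 2 by ring]
    norm_num
    ring
  have := constant_of_derivWithin_zero (f := G) (a := 0) (b := l)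
    (fun x hx => (hG x hx).differentiableAt.differentiableWithinAt)
    (fun x hx => (hG x (Ico_subset_Icc_self hx)).hasDerivWithinAt.derivWithin
      (uniqueDiffOn_Icc l_pos x (Ico_subset_Icc_self hx))) a ha
  simp only [G, potential_zero, mul_zero, sub_zero, zero_mul] at this
  linarith

/-- In log y, the slope of the potential is at least U(θ) on [a, 1-2a] and at most U(θ) on [1-2a,
1], where θ = a(1-2a)². The potential therefore stays below its log-tangent at 1-2a. -/
lemma potential_le_right (hk : Continuous k) (hU : MonotoneOn (fun t => t * k t) (Icc 0 1))
    {a y : ℝ} (ha : 0 < a) (hal : a ≤ l) (hy : a ≤ y) (hy1 : y ≤ 1) :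
    potential k y ≤ potential k (1 - 2 * a) + (a * (1 - 2 * a) ^ 2) * k (a * (1 - 2 * a) ^ 2) *
      (Real.log y - Real.log (1 - 2 * a)) := by
  have hl := l_lt_sixth
  have hθ : a * (1 - 2 * a) ^ 2 ∈ Icc (0 : ℝ) 1 := by
    rw [← mul_lam_of_le hal]
    exact mul_lam_mem ⟨ha.le, by linarith⟩
  rcases le_total y (1 - 2 * a) with h | h
  · have := mul_log_le_sub (c := (a * (1 - 2 * a) ^ 2) * k (a * (1 - 2 * a) ^ 2))
      (ha.trans_le hy) h (fun t _ => hasDerivAt_potential hk t) fun t ht => by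
        have := hU hθ (mul_lam_mem ⟨by linarith [ht.1], by linarith [ht.2]⟩)
          (mul_sq_le_mul_lam ha.le hal (hy.trans ht.1) ht.2)
        simp only at this
        linarith
    linarith
  · have := sub_le_mul_log (c := (a * (1 - 2 * a) ^ 2) * k (a * (1 - 2 * a) ^ 2))
      (by linarith) h (fun t _ => hasDerivAt_potential hk t) fun t ht => by
        have := hU (mul_lam_mem ⟨by linarith [ht.1], by linarith [ht.2]⟩) hθ
          (mul_lam_le_mul_sq hal ht.1 (ht.2.trans hy1))
        simp only at this
        linarith
    linarith

/-- The slope in log x never exceeds its value on the plateau, because tλ(t) ≤ lr². -/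
lemma potential_le_left (hk : Continuous k) (hU : MonotoneOn (fun t => t * k t) (Icc 0 1))
    {x : ℝ} (hx : l ≤ x) (hx1 : x ≤ 1) :
    potential k x ≤ potential k l + l * r ^ 2 * k (l * r ^ 2) * (Real.log x - Real.log l) := by
  have hl := l_pos
  have := sub_le_mul_log (c := l * r ^ 2 * k (l * r ^ 2))
    hl hx (fun t _ => hasDerivAt_potential hk t) fun t ht => by
      have ht' : t ∈ Icc (0 : ℝ) 1 := ⟨by linarith [ht.1], by linarith [ht.2]⟩
      have := hU (mul_lam_mem ht')
        (show l * r ^ 2 ∈ Icc (0 : ℝ) 1 by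
          rw [← mul_lam_of_mem (left_mem_Icc.2 l_lt_r.le)]
          exact mul_lam_mem ⟨hl.le, by linarith [l_lt_sixth]⟩) (mul_lam_le ht')
      simp only at this
      linarith
  linarith

lemma potential_eq_center (hk : Continuous k) {x : ℝ} (hx : x ∈ Icc l r) :
    potential k x = potential k l + l * r ^ 2 * k (l * r ^ 2) * (Real.log x - Real.log l) := by
  have h : ∀ t ∈ Icc l x, t * (lam t * k (t * lam t)) = l * r ^ 2 * k (l * r ^ 2) := by
    intro t ht
    rw [← mul_assoc, mul_lam_of_mem ⟨ht.1, ht.2.trans hx.2⟩]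
  have h1 := sub_le_mul_log l_pos hx.1 (fun t _ => hasDerivAt_potential hk t)
    fun t ht => (h t ht).le
  have h2 := mul_log_le_sub l_pos hx.1 (fun t _ => hasDerivAt_potential hk t)
    fun t ht => (h t ht).ge
  linarith

/-- Monotonicity and U(0) = 0 make k nonnegative on (0, 1]. This settles the case of a vanishing
coordinate, where logarithms are unavailable. -/
lemma monotoneOn_potential (hk : Continuous k) (hU : MonotoneOn (fun t => t * k t) (Icc 0 1)) :
    MonotoneOn (potential k) (Icc 0 1) := by
  refine monotoneOn_of_deriv_nonneg (convex_Icc 0 1) (continuous_potential hk).continuousOn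
    (fun t _ => (hasDerivAt_potential hk t).differentiableAt.differentiableWithinAt)
    fun t ht => ?_
  rw [interior_Icc] at ht
  have ht' := Ioo_subset_Icc_self ht
  have h := hU (left_mem_Icc.2 zero_le_one) (mul_lam_mem ht') (mul_lam_mem ht').1
  simp only [zero_mul, mul_assoc] at h
  rw [(hasDerivAt_potential hk t).deriv]
  exact nonneg_of_mul_nonneg_right h ht.1

lemma potential_add_le_of_le (hk : Continuous k) (hC : ∀ t, HasDerivAt C (k t) t)
    (hU : MonotoneOn (fun t => t * k t) (Icc 0 1)) {x y z : ℝ} (hx0 : 0 ≤ x) (hxy : x ≤ y)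
    (hxz : x ≤ z) (hy1 : y ≤ 1) (hz1 : z ≤ 1) :
    potential k x + potential k y + potential k z ≤ C (x * y * z) - C 0 + 2 * potential k 1 := by
  have hl := l_lt_sixth
  rcases hx0.eq_or_lt with rfl | hx
  · have h1 := monotoneOn_potential hk hU ⟨hxy, hy1⟩ (right_mem_Icc.2 zero_le_one) hy1
    have h2 := monotoneOn_potential hk hU ⟨hxz, hz1⟩ (right_mem_Icc.2 zero_le_one) hz1
    simp only [potential_zero, zero_mul]
    linarith
  have hy := hx.trans_le hxy
  have hz := hx.trans_le hxz
  have hlog : Real.log (x * y * z) = Real.log x + Real.log y + Real.log z := by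
    rw [Real.log_mul (by positivity) hz.ne', Real.log_mul hx.ne' hy.ne']
  -- The contact point is (a, 1-2a, 1-2a) with a = min(x, l). The three log-affine bounds share one
  -- slope, so their sum is the log-tangent to C at a(1-2a)², evaluated at xyz.
  have key : ∀ a, 0 < a → a ≤ l → a ≤ x →
      potential k x ≤ potential k a + (a * (1 - 2 * a) ^ 2) * k (a * (1 - 2 * a) ^ 2) *
        (Real.log x - Real.log a) →
      potential k x + potential k y + potential k z
        ≤ C (x * y * z) - C 0 + 2 * potential k 1 := by
    intro a ha hal hax h
    have hb : 0 < 1 - 2 * a := by linarith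
    have e := potential_arm hk hC ⟨ha.le, hal⟩
    have h1 := potential_le_right hk hU ha hal (hax.trans hxy) hy1
    have h2 := potential_le_right hk hU ha hal (hax.trans hxz) hz1
    have hθ1 : a * (1 - 2 * a) ^ 2 ≤ 1 := by
      rw [← mul_lam_of_le hal]
      exact (mul_lam_mem ⟨ha.le, by linarith⟩).2
    have h3 := add_mul_log_le hC hU (θ := a * (1 - 2 * a) ^ 2) (s := x * y * z) (by positivity)
      hθ1 (by positivity) (mul_le_one₀ (mul_le_one₀ (hxy.trans hy1) hy.le hy1) hz.le hz1)
    rw [hlog, Real.log_mul ha.ne' (by positivity), Real.log_pow] at h3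
    push_cast at h3
    linarith
  rcases le_total x l with h | h
  · exact key x hx h le_rfl (by simp)
  · exact key l l_pos le_rfl h (potential_le_left hk hU h (hxy.trans hy1))

/-- Feasibility of the candidate potentials. -/
lemma potential_add_le (hk : Continuous k) (hC : ∀ t, HasDerivAt C (k t) t)
    (hU : MonotoneOn (fun t => t * k t) (Icc 0 1)) {x y z : ℝ} (hx : x ∈ Icc (0 : ℝ) 1)
    (hy : y ∈ Icc (0 : ℝ) 1) (hz : z ∈ Icc (0 : ℝ) 1) :
    potential k x + potential k y + potential k z ≤ C (x * y * z) - C 0 + 2 * potential k 1 := by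
  rcases le_total x y with h1 | h1
  · rcases le_total x z with h2 | h2
    · exact potential_add_le_of_le hk hC hU hx.1 h1 h2 hy.2 hz.2
    · have := potential_add_le_of_le hk hC hU hz.1 h2 (h2.trans h1) hx.2 hy.2
      rw [show z * x * y = x * y * z by ring] at this
      linarith
  · rcases le_total y z with h2 | h2
    · have := potential_add_le_of_le hk hC hU hy.1 h1 h2 hx.2 hz.2
      rw [show y * x * z = x * y * z by ring] at this
      linarith
    · have := potential_add_le_of_le hk hC hU hz.1 (h2.trans h1) h2 hx.2 hy.2
      rw [show z * x * y = x * y * z by ring] at this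
      linarith

/-- Complementary slackness. -/
lemma OnSupport.potential_add_eq (hk : Continuous k) (hC : ∀ t, HasDerivAt C (k t) t)
    {x y z : ℝ} (h : OnSupport x y z) :
    potential k x + potential k y + potential k z = C (x * y * z) - C 0 + 2 * potential k 1 := by
  rcases h with ⟨a, ha, ⟨rfl, rfl, rfl⟩ | ⟨rfl, rfl, rfl⟩ | ⟨rfl, rfl, rfl⟩⟩ | ⟨h1, h2, h3, h4⟩
  · have := potential_arm hk hC ha
    rw [show x * (1 - 2 * x) * (1 - 2 * x) = x * (1 - 2 * x) ^ 2 by ring]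
    linarith
  · have := potential_arm hk hC ha
    rw [show (1 - 2 * y) * y * (1 - 2 * y) = y * (1 - 2 * y) ^ 2 by ring]
    linarith
  · have := potential_arm hk hC ha
    rw [show (1 - 2 * z) * (1 - 2 * z) * z = z * (1 - 2 * z) ^ 2 by ring]
    linarith
  -- On [l, r] the potential is affine in the logarithm, so the sum depends only on log(xyz) and
  -- agrees with its value at the end (l, r, r) of an arm.
  · have e := potential_arm hk hC (right_mem_Icc.2 l_pos.le)
    rw [← r_eq, potential_eq_center hk (right_mem_Icc.2 l_lt_r.le)] at e
    have hx := l_pos.trans_le h1.1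
    have hy := l_pos.trans_le h2.1
    have hz := l_pos.trans_le h3.1
    have hlog : Real.log (x * y * z) = Real.log x + Real.log y + Real.log z := by
      rw [Real.log_mul (by positivity) hz.ne', Real.log_mul hx.ne' hy.ne']
    have hlog' : Real.log (l * r ^ 2) = Real.log l + 2 * Real.log r := by
      rw [Real.log_mul l_pos.ne' (pow_ne_zero 2 r_pos.ne'), Real.log_pow]
      norm_num
    rw [potential_eq_center hk h1, potential_eq_center hk h2, potential_eq_center hk h3, h4]
    rw [h4, hlog'] at hlog
    have : l * r ^ 2 * k (l * r ^ 2) * (Real.log x + Real.log y + Real.log z)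
      = l * r ^ 2 * k (l * r ^ 2) * (Real.log l + 2 * Real.log r) := by rw [hlog]
    linarith

end Potential

/-! ### A symmetric measure on `s₁ + s₂ + s₃ = 0` with exponential marginals -/

/-- After multiplication by e^{-D} the difference of the two sides is increasing, by 1 + t + t²/2 ≤
e^t. This is the positivity of `medianDensity`. -/
lemma three_sub_mul_exp_le {D : ℝ} (hD : 0 ≤ D) :
    (3 - D) * Real.exp D ≤ 3 + 2 * D + D ^ 2 / 2 := by
  set g : ℝ → ℝ := fun D => (3 + 2 * D + D ^ 2 / 2) * Real.exp (-D) + D with hg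
  have hd : ∀ t, HasDerivAt g (1 - (1 + t + t ^ 2 / 2) * Real.exp (-t)) t := by
    intro t
    have e1 : HasDerivAt (fun D : ℝ => 3 + 2 * D + D ^ 2 / 2) (2 + t) t := by
      refine ((((hasDerivAt_id t).const_mul (2 : ℝ)).const_add 3).add
        (((hasDerivAt_id t).pow 2).div_const 2)).congr_deriv ?_
      norm_num
    refine ((e1.mul (hasDerivAt_neg t).exp).add (hasDerivAt_id t)).congr_deriv ?_
    ring
  have hm : MonotoneOn g (Ici 0) := by
    refine monotoneOn_of_deriv_nonneg (convex_Ici 0)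
      (fun t _ => (hd t).continuousAt.continuousWithinAt)
      (fun t _ => (hd t).differentiableAt.differentiableWithinAt) fun t ht => ?_
    rw [interior_Ici] at ht
    rw [(hd t).deriv, sub_nonneg, Real.exp_neg, ← div_eq_mul_inv, div_le_one (Real.exp_pos t)]
    exact Real.quadratic_le_exp_of_nonneg (le_of_lt ht)
  have h := hm self_mem_Ici hD hD
  simp only [hg, Real.exp_zero, Real.exp_neg, ← div_eq_mul_inv] at h
  have h' : 3 - D ≤ (3 + 2 * D + D ^ 2 / 2) / Real.exp D := by linarith
  rwa [le_div_iff₀ (Real.exp_pos D)] at h'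

/-- The same method, the sign of the derivative now coming from `three_sub_mul_exp_le`. This is the
positivity of `chordDensity`. -/
lemma le_mul_exp {D : ℝ} (hD : 0 ≤ D) :
    18 + 12 * D + 4 * D ^ 2 ≤ (18 - 6 * D + D ^ 2) * Real.exp D := by
  set g : ℝ → ℝ := fun D => 18 - 6 * D + D ^ 2 - (18 + 12 * D + 4 * D ^ 2) * Real.exp (-D) with hg
  have hd : ∀ t, HasDerivAt g (2 * ((3 + 2 * t + 2 * t ^ 2) * Real.exp (-t) - (3 - t))) t := by
    intro t
    have e1 : HasDerivAt (fun D : ℝ => 18 + 12 * D + 4 * D ^ 2) (12 + 8 * t) t := by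
      refine ((((hasDerivAt_id t).const_mul (12 : ℝ)).const_add 18).add
        (((hasDerivAt_id t).pow 2).const_mul 4)).congr_deriv ?_
      norm_num
      ring
    have e2 : HasDerivAt (fun D : ℝ => 18 - 6 * D + D ^ 2) (-6 + 2 * t) t := by
      refine ((((hasDerivAt_id t).const_mul (6 : ℝ)).const_sub 18).add
        ((hasDerivAt_id t).pow 2)).congr_deriv ?_
      norm_num
    refine (e2.sub (e1.mul (hasDerivAt_neg t).exp)).congr_deriv ?_
    ring
  have hm : MonotoneOn g (Ici 0) := by
    refine monotoneOn_of_deriv_nonneg (convex_Ici 0)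
      (fun t _ => (hd t).continuousAt.continuousWithinAt)
      (fun t _ => (hd t).differentiableAt.differentiableWithinAt) fun t ht => ?_
    rw [interior_Ici] at ht
    have h0 : 0 ≤ t := le_of_lt ht
    have : 3 - t ≤ (3 + 2 * t + 2 * t ^ 2) / Real.exp t := by
      rw [le_div_iff₀ (Real.exp_pos t)]
      nlinarith [three_sub_mul_exp_le h0, sq_nonneg t]
    rw [(hd t).deriv, Real.exp_neg, ← div_eq_mul_inv]
    linarith
  have h := hm self_mem_Ici hD hD
  simp only [hg, Real.exp_zero, Real.exp_neg, ← div_eq_mul_inv] at h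
  have h' : (18 + 12 * D + 4 * D ^ 2) / Real.exp D ≤ 18 - 6 * D + D ^ 2 := by linarith
  rwa [div_le_iff₀ (Real.exp_pos D)] at h'

/-- The primitive of the density of the chords. -/
noncomputable def chordMass (D : ℝ) : ℝ :=
  ((3 - D) * Real.exp (D / 3) - (3 + 2 * D) * Real.exp (-2 * D / 3)) / D ^ 2

/-- The density in `D` of the chords `{(-D, s, D - s) : -D ≤ s ≤ 2D}`. -/
noncomputable def chordDensity (D : ℝ) : ℝ :=
  (Real.exp (D / 3) - 4 * Real.exp (-2 * D / 3) + 6 * chordMass D) / (3 * D)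

/-- The density in `D` of the points `(-D, -D, 2D)`. -/
noncomputable def medianDensity (D : ℝ) : ℝ := 2 * Real.exp (-2 * D / 3) - 4 * chordMass D

lemma measurable_chordMass : Measurable chordMass := by unfold chordMass; fun_prop

lemma measurable_chordDensity : Measurable chordDensity := by
  have := measurable_chordMass
  unfold chordDensity
  fun_prop

lemma measurable_medianDensity : Measurable medianDensity := by
  have := measurable_chordMass
  unfold medianDensity
  fun_prop

lemma exp_div_three (D : ℝ) : Real.exp (D / 3) = Real.exp (-2 * D / 3) * Real.exp D := by
  rw [← Real.exp_add]; ring_nf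

lemma chordMass_eq (D : ℝ) :
    chordMass D = Real.exp (-2 * D / 3) * ((3 - D) * Real.exp D - (3 + 2 * D)) / D ^ 2 := by
  rw [chordMass, exp_div_three]; ring

lemma medianDensity_nonneg {D : ℝ} (hD : 0 < D) : 0 ≤ medianDensity D := by
  have h : (3 - D) * Real.exp D - (3 + 2 * D) ≤ D ^ 2 / 2 := by linarith [three_sub_mul_exp_le hD.le]
  have : chordMass D ≤ Real.exp (-2 * D / 3) / 2 := by
    rw [chordMass_eq, div_le_iff₀ (by positivity)]
    nlinarith [Real.exp_pos (-2 * D / 3)]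
  rw [medianDensity]
  linarith

lemma chordDensity_nonneg {D : ℝ} (hD : 0 < D) : 0 ≤ chordDensity D := by
  refine div_nonneg ?_ (by linarith)
  have h := le_mul_exp hD.le
  have e : Real.exp (D / 3) - 4 * Real.exp (-2 * D / 3) + 6 * chordMass D
      = Real.exp (-2 * D / 3) *
        ((18 - 6 * D + D ^ 2) * Real.exp D - (18 + 12 * D + 4 * D ^ 2)) / D ^ 2 := by
    rw [chordMass_eq, exp_div_three]
    field_simp
    ring
  rw [e]
  exact div_nonneg (mul_nonneg (Real.exp_pos _).le (by linarith)) (by positivity)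

/-- The marginal condition at s = -D, with `medianDensity` eliminated through the condition at s =
2D, becomes 3D W' + 6W + e^{D/3} - 4e^{-2D/3} = 0; `chordMass` is an explicit solution W. -/
lemma hasDerivAt_chordMass {D : ℝ} (hD : D ≠ 0) : HasDerivAt chordMass (-chordDensity D) D := by
  have e1 : HasDerivAt (fun D : ℝ => Real.exp (D / 3)) (Real.exp (D / 3) * (1 / 3)) D :=
    ((hasDerivAt_id D).div_const 3).exp
  have e2 : HasDerivAt (fun D : ℝ => Real.exp (-2 * D / 3))
      (Real.exp (-2 * D / 3) * (-2 * 1 / 3)) D :=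
    (((hasDerivAt_id D).const_mul (-2 : ℝ)).div_const 3).exp
  have e3 : HasDerivAt (fun D : ℝ => 3 - D) (-1) D := (hasDerivAt_id D).const_sub 3
  have e4 : HasDerivAt (fun D : ℝ => 3 + 2 * D) (2 * 1) D :=
    ((hasDerivAt_id D).const_mul (2 : ℝ)).const_add 3
  refine (((e3.mul e1).sub (e4.mul e2)).div ((hasDerivAt_id D).pow 2)
    (pow_ne_zero 2 hD)).congr_deriv ?_
  simp only [chordDensity, chordMass, id, Pi.sub_apply, Pi.mul_apply]
  norm_num
  field_simp
  ring

/-- W decreases to W(L) = 0. The vanishing at L is the balance condition `hbal`, equivalent to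
e^{-s/3} having first moment zero on [-L, 2L]. -/
lemma chordMass_nonneg {L D : ℝ} (hbal : (3 - L) * Real.exp L = 3 + 2 * L) (hD : 0 < D)
    (hDL : D ≤ L) : 0 ≤ chordMass D := by
  have hL : chordMass L = 0 := by rw [chordMass_eq, hbal]; simp
  have hder : ∀ t ∈ Icc D L, HasDerivAt chordMass (-chordDensity t) t := fun t ht =>
    hasDerivAt_chordMass (hD.trans_le ht.1).ne'
  rw [← hL]
  refine antitoneOn_of_deriv_nonpos (convex_Icc D L)
    (fun t ht => (hder t ht).continuousAt.continuousWithinAt)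
    (fun t ht => (hder t (interior_subset ht)).differentiableAt.differentiableWithinAt)
    (fun t ht => ?_) (left_mem_Icc.2 hDL) (right_mem_Icc.2 hDL) hDL
  have ht := interior_subset ht
  rw [(hder t ht).deriv, neg_nonpos]
  exact chordDensity_nonneg (hD.trans_le ht.1)

lemma lintegral_chordDensity {L D : ℝ} (hbal : (3 - L) * Real.exp L = 3 + 2 * L) (hD : 0 < D)
    (hDL : D ≤ L) :
    ∫⁻ t in Icc D L, ENNReal.ofReal (chordDensity t) = ENNReal.ofReal (chordMass D) := by
  have hL : chordMass L = 0 := by rw [chordMass_eq, hbal]; simp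
  have hder : ∀ t ∈ Icc D L, HasDerivAt chordMass (-chordDensity t) t := fun t ht =>
    hasDerivAt_chordMass (hD.trans_le ht.1).ne'
  have hcM : ContinuousOn chordMass (Icc D L) := fun t ht =>
    (hder t ht).continuousAt.continuousWithinAt
  have hc : ContinuousOn chordDensity (Icc D L) := by
    unfold chordDensity
    refine ContinuousOn.div (by fun_prop) (by fun_prop) fun t ht => ?_
    have := hD.trans_le ht.1
    positivity
  have hint : IntervalIntegrable chordDensity volume D L :=
    ContinuousOn.intervalIntegrable (by rwa [uIcc_of_le hDL])
  rw [← Measure.restrict_congr_set Ioc_ae_eq_Icc, ← ofReal_integral_eq_lintegral_ofReal hint.1,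
    ← intervalIntegral.integral_of_le hDL]
  · congr 1
    have := intervalIntegral.integral_eq_sub_of_hasDerivAt (a := D) (b := L) (f := chordMass)
      (f' := fun t => -chordDensity t) (by rwa [uIcc_of_le hDL]) hint.neg
    rw [intervalIntegral.integral_neg, hL] at this
    linarith
  · filter_upwards [ae_restrict_mem measurableSet_Ioc] with t ht
    exact chordDensity_nonneg (hD.trans ht.1)

lemma lintegral_Icc_neg_two_mul {L : ℝ} (hL : 0 < L) (G : ℝ → ENNReal) (hG : Measurable G) :
    ∫⁻ s in Icc (-L) (2 * L), G s
      = ∫⁻ D in Ioc 0 L, (G (-D) + 2 * G (2 * D)) := by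
  have h1 : ∫⁻ s in Ico (-L) 0, G s = ∫⁻ D in Ioc 0 L, G (-D) := by
    have := lintegral_image_eq_lintegral_abs_deriv_mul (s := Ioc 0 L) (f := fun D : ℝ => -D)
      (f' := fun _ => -1) measurableSet_Ioc
      (fun x _ => (hasDerivAt_neg x).hasDerivWithinAt) neg_injective.injOn G
    simpa using this
  have h2 : ∫⁻ s in Ioc 0 (2 * L), G s = ∫⁻ D in Ioc 0 L, 2 * G (2 * D) := by
    have := lintegral_image_eq_lintegral_abs_deriv_mul (s := Ioc 0 L) (f := fun D : ℝ => 2 * D)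
      (f' := fun _ => 2) measurableSet_Ioc
      (fun x _ => by simpa using ((hasDerivAt_id x).const_mul (2 : ℝ)).hasDerivWithinAt)
      (mul_right_injective₀ two_ne_zero).injOn G
    rw [image_mul_left_Ioc two_pos, mul_zero] at this
    simpa using this
  rw [lintegral_add_left (by fun_prop), ← h1, ← h2,
    ← Ico_union_Icc_eq_Icc (neg_nonpos.2 hL.le) (by linarith : (0 : ℝ) ≤ 2 * L),
    lintegral_union measurableSet_Icc, ← Measure.restrict_congr_set (Ioc_ae_eq_Icc (a := (0 : ℝ)))]
  exact Set.disjoint_left.2 fun x h h' => absurd h.2 (not_lt.2 h'.1)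

/-- By Tonelli: s lies in [-D, 2D] exactly when max(-s, s/2) ≤ D, so the weight at s is the tail
integral of `chordDensity` from that level. -/
lemma lintegral_chords {L : ℝ} (hbal : (3 - L) * Real.exp L = 3 + 2 * L)
    (φ : ℝ → ENNReal) (hφ : Measurable φ) :
    ∫⁻ D in Ioc 0 L, ∫⁻ s in Icc (-D) (2 * D), ENNReal.ofReal (chordDensity D) * φ s
      = ∫⁻ s in Icc (-L) (2 * L), ENNReal.ofReal (chordMass (max (-s) (s / 2))) * φ s := by
  have hw := measurable_chordDensity
  have hR : MeasurableSet {p : ℝ × ℝ | p.1 ∈ Ioc 0 L ∧ p.2 ∈ Icc (-p.1) (2 * p.1)} :=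
    (measurable_fst measurableSet_Ioc).inter
      ((measurableSet_le measurable_fst.neg measurable_snd).inter
        (measurableSet_le measurable_snd (measurable_fst.const_mul 2)))
  set R := {p : ℝ × ℝ | p.1 ∈ Ioc 0 L ∧ p.2 ∈ Icc (-p.1) (2 * p.1)} with hRdef
  set F : ℝ × ℝ → ENNReal :=
    R.indicator fun p => ENNReal.ofReal (chordDensity p.1) * φ p.2 with hF
  have hFm : Measurable F := Measurable.indicator (by fun_prop) hR
  have F_mem : ∀ {D s}, D ∈ Ioc 0 L → s ∈ Icc (-D) (2 * D) →
      F (D, s) = ENNReal.ofReal (chordDensity D) * φ s := fun {D s} h h' =>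
    indicator_of_mem (show (D, s) ∈ R from ⟨h, h'⟩) _
  have F_notMem : ∀ {D s}, ¬ (D ∈ Ioc 0 L ∧ s ∈ Icc (-D) (2 * D)) → F (D, s) = 0 :=
    fun {D s} h => indicator_of_notMem (show (D, s) ∉ R from h) _
  have e1 : ∫⁻ D in Ioc 0 L, ∫⁻ s in Icc (-D) (2 * D), ENNReal.ofReal (chordDensity D) * φ s
      = ∫⁻ D, ∫⁻ s, F (D, s) := by
    rw [← lintegral_indicator measurableSet_Ioc]
    refine lintegral_congr fun D => ?_
    by_cases hD : D ∈ Ioc 0 L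
    · rw [indicator_of_mem hD, ← lintegral_indicator measurableSet_Icc]
      refine lintegral_congr fun s => ?_
      by_cases hs : s ∈ Icc (-D) (2 * D)
      · rw [indicator_of_mem hs, F_mem hD hs]
      · rw [indicator_of_notMem hs, F_notMem fun h => hs h.2]
    · rw [indicator_of_notMem hD, lintegral_congr fun s => F_notMem fun h => hD h.1,
        lintegral_zero]
  have e2 : ∫⁻ D, ∫⁻ s, F (D, s) = ∫⁻ s, ∫⁻ D, F (D, s) :=
    lintegral_lintegral_swap (f := fun D s => F (D, s)) hFm.aemeasurable
  rw [e1, e2, ← lintegral_indicator measurableSet_Icc]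
  refine lintegral_congr_ae ?_
  have h0 : ∀ᵐ s : ℝ, s ≠ 0 := by simp [ae_iff]
  filter_upwards [h0] with s hs0
  by_cases hs : s ∈ Icc (-L) (2 * L)
  · rw [indicator_of_mem hs]
    have hm : 0 < max (-s) (s / 2) := by
      rcases lt_or_gt_of_ne hs0 with h | h
      · exact lt_max_of_lt_left (by linarith)
      · exact lt_max_of_lt_right (by linarith)
    have hmL : max (-s) (s / 2) ≤ L := max_le (by linarith [hs.1]) (by linarith [hs.2])
    rw [← lintegral_chordDensity hbal hm hmL, ← lintegral_indicator measurableSet_Icc,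
      ← lintegral_mul_const _ (Measurable.indicator (by fun_prop) measurableSet_Icc)]
    refine lintegral_congr fun D => ?_
    by_cases hD : D ∈ Icc (max (-s) (s / 2)) L
    · have h1 := (le_max_left _ _).trans hD.1
      have h2 := (le_max_right _ _).trans hD.1
      rw [indicator_of_mem hD, F_mem ⟨hm.trans_le hD.1, hD.2⟩ ⟨by linarith, by linarith⟩]
    · rw [indicator_of_notMem hD, zero_mul, F_notMem]
      rintro ⟨h1, h2⟩
      exact hD ⟨max_le (by linarith [h2.1]) (by linarith [h2.2]), h1.2⟩
  · rw [indicator_of_notMem hs]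
    rw [lintegral_congr fun D => F_notMem ?_, lintegral_zero]
    rintro ⟨h1, h2⟩
    exact hs ⟨by linarith [h1.2, h2.1], by linarith [h1.2, h2.2]⟩

/-- The marginal identity behind the central part of the optimal plan. -/
lemma lintegral_median_add_chords {L : ℝ} (hL : 0 < L)
    (hbal : (3 - L) * Real.exp L = 3 + 2 * L) (φ : ℝ → ENNReal) (hφ : Measurable φ) :
    (∫⁻ D in Ioc 0 L, ENNReal.ofReal (medianDensity D) * (φ (-D) + φ (-D) + φ (2 * D)))
      + ∫⁻ D in Ioc 0 L, ∫⁻ s in Icc (-D) (2 * D),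
        ENNReal.ofReal (chordDensity D) * (φ (-D) + φ s + φ (D - s))
      = ∫⁻ s in Icc (-L) (2 * L), ENNReal.ofReal (Real.exp (-s / 3)) * φ s := by
  have hw := measurable_chordDensity
  have hv := measurable_medianDensity
  have hW := measurable_chordMass
  have inner : ∀ D ∈ Ioc 0 L, ∫⁻ s in Icc (-D) (2 * D),
        ENNReal.ofReal (chordDensity D) * (φ (-D) + φ s + φ (D - s))
      = ENNReal.ofReal (3 * D * chordDensity D) * φ (-D)
        + 2 * ∫⁻ s in Icc (-D) (2 * D), ENNReal.ofReal (chordDensity D) * φ s := by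
    intro D hD
    have hrefl : ∫⁻ s in Icc (-D) (2 * D), ENNReal.ofReal (chordDensity D) * φ (D - s)
        = ∫⁻ s in Icc (-D) (2 * D), ENNReal.ofReal (chordDensity D) * φ s := by
      have := lintegral_image_eq_lintegral_abs_deriv_mul (s := Icc (-D) (2 * D))
        (f := fun s : ℝ => D - s) (f' := fun _ => -1) measurableSet_Icc
        (fun x _ => ((hasDerivAt_id x).const_sub D).hasDerivWithinAt)
        (fun a _ b _ h => by simpa using h) (fun s => ENNReal.ofReal (chordDensity D) * φ s)
      rw [image_const_sub_Icc] at this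
      rw [show D - 2 * D = -D by ring, show D - -D = 2 * D by ring] at this
      simpa using this.symm
    simp only [mul_add]
    rw [lintegral_add_left (by fun_prop), lintegral_add_left (by fun_prop), hrefl,
      setLIntegral_const, Real.volume_Icc, show 2 * D - -D = 3 * D by ring,
      ENNReal.ofReal_mul (by linarith [hD.1] : 0 ≤ 3 * D), two_mul, add_assoc]
    ring
  rw [setLIntegral_congr_fun measurableSet_Ioc inner, lintegral_add_left (by fun_prop),
    lintegral_const_mul' _ _ (by simp), lintegral_chords hbal φ hφ,
    lintegral_Icc_neg_two_mul hL _ (by fun_prop), lintegral_Icc_neg_two_mul hL _ (by fun_prop),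
    ← lintegral_const_mul _ (by fun_prop), ← lintegral_add_left (by fun_prop),
    ← lintegral_add_left (by fun_prop)]
  refine setLIntegral_congr_fun measurableSet_Ioc fun D hD => ?_
  have hD0 : 0 < D := hD.1
  have hv0 := medianDensity_nonneg hD0
  have hw0 := chordDensity_nonneg hD0
  have hW0 : 0 ≤ chordMass D := chordMass_nonneg hbal hD0 hD.2
  simp only [neg_neg]
  rw [max_eq_left (by linarith : -D / 2 ≤ D), max_eq_right (by linarith : -(2 * D) ≤ 2 * D / 2),
    mul_div_cancel_left₀ D two_ne_zero]
  -- The marginal condition at s = -D: two coordinates of the median point, the fixed coordinate of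
  -- a chord of length 3D, and the two moving coordinates of the chords of higher level.
  have i1 : ENNReal.ofReal (Real.exp (D / 3)) = 2 * ENNReal.ofReal (medianDensity D)
      + ENNReal.ofReal (3 * D * chordDensity D) + 2 * ENNReal.ofReal (chordMass D) := by
    rw [← ENNReal.ofReal_ofNat 2, ← ENNReal.ofReal_mul zero_le_two,
      ← ENNReal.ofReal_mul zero_le_two, ← ENNReal.ofReal_add (by positivity) (by positivity),
      ← ENNReal.ofReal_add (by positivity) (by positivity)]
    congr 1
    rw [medianDensity, chordDensity]
    field_simp
    ring
  -- The condition at s = 2D; the factor 2 on the left is the Jacobian of D ↦ 2D.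
  have i2 : 2 * ENNReal.ofReal (Real.exp (-(2 * D) / 3)) = ENNReal.ofReal (medianDensity D)
      + 4 * ENNReal.ofReal (chordMass D) := by
    rw [← ENNReal.ofReal_ofNat 2, ← ENNReal.ofReal_ofNat 4, ← ENNReal.ofReal_mul zero_le_two,
      ← ENNReal.ofReal_mul zero_le_four, ← ENNReal.ofReal_add (by positivity) (by positivity)]
    congr 1
    rw [medianDensity, neg_mul]
    ring
  rw [i1, ← mul_assoc 2 (ENNReal.ofReal (Real.exp _)), i2]
  ring

/-- A measure on triples of real numbers with sum zero, the sum of whose marginals has density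
`e^{-s/3}` on `[-L, 2L]`. -/
lemma exists_balanced_measure {L : ℝ} (hL : 0 < L) (hbal : (3 - L) * Real.exp L = 3 + 2 * L) :
    ∃ κ : Measure (ℝ × ℝ × ℝ),
      (∀ φ : ℝ → ENNReal, Measurable φ → ∫⁻ p, (φ p.1 + φ p.2.1 + φ p.2.2) ∂κ
        = ∫⁻ s in Icc (-L) (2 * L), ENNReal.ofReal (Real.exp (-s / 3)) * φ s) ∧
      ∀ᵐ p ∂κ, p.1 ∈ Icc (-L) (2 * L) ∧ p.2.1 ∈ Icc (-L) (2 * L) ∧ p.2.2 ∈ Icc (-L) (2 * L) ∧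
        p.1 + p.2.1 + p.2.2 = 0 := by
  have hw := measurable_chordDensity
  have hv := measurable_medianDensity
  have hR : MeasurableSet {p : ℝ × ℝ | p.1 ∈ Ioc 0 L ∧ p.2 ∈ Icc (-p.1) (2 * p.1)} :=
    (measurable_fst measurableSet_Ioc).inter
      ((measurableSet_le measurable_fst.neg measurable_snd).inter
        (measurableSet_le measurable_snd (measurable_fst.const_mul 2)))
  set R := {p : ℝ × ℝ | p.1 ∈ Ioc 0 L ∧ p.2 ∈ Icc (-p.1) (2 * p.1)} with hRdef
  set T₁ : ℝ → ℝ × ℝ × ℝ := fun D => (-D, -D, 2 * D) with hT₁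
  set T₂ : ℝ × ℝ → ℝ × ℝ × ℝ := fun p => (-p.1, p.2, p.1 - p.2) with hT₂
  have hT₁m : Measurable T₁ := by fun_prop
  have hT₂m : Measurable T₂ := by fun_prop
  have hP : MeasurableSet {p : ℝ × ℝ × ℝ | p.1 ∈ Icc (-L) (2 * L) ∧ p.2.1 ∈ Icc (-L) (2 * L) ∧
      p.2.2 ∈ Icc (-L) (2 * L) ∧ p.1 + p.2.1 + p.2.2 = 0} :=
    (measurable_fst measurableSet_Icc).inter
      ((measurable_snd.fst measurableSet_Icc).inter
        ((measurable_snd.snd measurableSet_Icc).inter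
          (measurableSet_eq_fun (by fun_prop) measurable_const)))
  -- The triangles {sᵢ ≥ -D} in the plane are nested. The first summand weights a vertex of each,
  -- the second spreads mass uniformly along a side.
  refine ⟨((volume.restrict (Ioc 0 L)).withDensity
      fun D => ENNReal.ofReal (medianDensity D)).map T₁
    + (((volume : Measure (ℝ × ℝ)).restrict R).withDensity
      fun p => ENNReal.ofReal (chordDensity p.1)).map T₂, fun φ hφ => ?_, ?_⟩
  · rw [lintegral_add_measure, lintegral_map (by fun_prop) hT₁m, lintegral_map (by fun_prop) hT₂m,
      lintegral_withDensity_eq_lintegral_mul _ (by fun_prop) (by fun_prop),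
      lintegral_withDensity_eq_lintegral_mul _ (by fun_prop) (by fun_prop),
      ← lintegral_median_add_chords hL hbal φ hφ]
    congr 1
    rw [← lintegral_indicator hR, Measure.volume_eq_prod,
      lintegral_prod _ (Measurable.indicator (by fun_prop) hR).aemeasurable,
      ← lintegral_indicator measurableSet_Ioc]
    refine lintegral_congr fun D => ?_
    by_cases hD : D ∈ Ioc 0 L
    · rw [indicator_of_mem hD, ← lintegral_indicator measurableSet_Icc]
      refine lintegral_congr fun s => ?_
      by_cases hs : s ∈ Icc (-D) (2 * D)
      · rw [indicator_of_mem hs, indicator_of_mem (show (D, s) ∈ R from ⟨hD, hs⟩)]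
        rfl
      · rw [indicator_of_notMem hs, indicator_of_notMem fun h : (D, s) ∈ R => hs h.2]
    · rw [indicator_of_notMem hD,
        lintegral_congr fun s => indicator_of_notMem (fun h : (D, s) ∈ R => hD h.1) _,
        lintegral_zero]
  · rw [ae_add_measure_iff]
    constructor
    · rw [ae_map_iff hT₁m.aemeasurable hP]
      refine (withDensity_absolutelyContinuous _ _).ae_le ?_
      filter_upwards [ae_restrict_mem measurableSet_Ioc] with D hD
      exact ⟨⟨by linarith [hD.2], by linarith [hD.1]⟩, ⟨by linarith [hD.2], by linarith [hD.1]⟩,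
        ⟨by linarith [hD.1], by linarith [hD.2]⟩, by simp only [hT₁]; ring⟩
    · rw [ae_map_iff hT₂m.aemeasurable hP]
      refine (withDensity_absolutelyContinuous _ _).ae_le ?_
      filter_upwards [ae_restrict_mem hR] with p hp
      obtain ⟨⟨h1, h2⟩, h3, h4⟩ := hp
      exact ⟨⟨by linarith, by linarith⟩, ⟨by linarith, by linarith⟩,
        ⟨by simp only [hT₂]; linarith, by simp only [hT₂]; linarith⟩, by simp only [hT₂]; ring⟩

/-! ### The optimal plan -/

lemma log_r_sub_log_l : Real.log r - Real.log l = 3 - 9 * l := by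
  have := l_spec.2
  rw [← r_eq] at this
  linarith

lemma exp_center : Real.exp (3 - 9 * l) = r / l := by
  rw [← log_r_sub_log_l, Real.exp_sub, Real.exp_log r_pos, Real.exp_log l_pos]

/-- The central part of the optimal plan. -/
lemma exists_center_measure :
    ∃ κ : Measure (ℝ × ℝ × ℝ),
      (∀ φ : ℝ → ENNReal, Measurable φ → ∫⁻ p, (φ p.1 + φ p.2.1 + φ p.2.2) ∂κ
        = ∫⁻ x in Icc l r, φ x) ∧
      ∀ᵐ p ∂κ, p.1 ∈ Icc l r ∧ p.2.1 ∈ Icc l r ∧ p.2.2 ∈ Icc l r ∧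
        p.1 * p.2.1 * p.2.2 = l * r ^ 2 := by
  set L := 3 - 9 * l with hL
  have hL0 : 0 < L := by linarith [l_lt_sixth]
  have hl := l_pos
  have hr := r_pos
  -- Here 3 - L = 9l, 3 + 2L = 9r and e^L = r/l, the last being the equation that defines l.
  have hbal : (3 - L) * Real.exp L = 3 + 2 * L := by
    rw [hL, exp_center, r_eq]
    field_simp
    ring
  obtain ⟨κ, hκ, hκs⟩ := exists_balanced_measure hL0 hbal
  set m := r * Real.exp (-L / 3) with hm
  have hm0 : 0 < m := by positivity
  -- With m³ = lr², this chart sends s₁ + s₂ + s₃ = 0 to xyz = lr² and [-L, 2L] to [l, r], reversing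
  -- order. Its Jacobian (m/3)e^{-s/3} explains both the exponential density and the factor m/3
  -- below.
  set ψ : ℝ → ℝ := fun s => m * Real.exp (-s / 3) with hψ
  have hψr : ψ (-L) = r := by
    simp only [hψ, hm]
    rw [mul_assoc, ← Real.exp_add, show -L / 3 + - -L / 3 = 0 by ring, Real.exp_zero, mul_one]
  have hψl : ψ (2 * L) = l := by
    simp only [hψ, hm]
    rw [mul_assoc, ← Real.exp_add, show -L / 3 + -(2 * L) / 3 = -L by ring, Real.exp_neg,
      exp_center]
    field_simp
  have hm3 : m ^ 3 = l * r ^ 2 := by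
    have : m ^ 3 = r ^ 3 * Real.exp (-L) := by
      rw [hm, mul_pow, ← Real.exp_nat_mul]
      congr 2
      push_cast
      ring
    rw [this, Real.exp_neg, exp_center]
    field_simp
  have hψd : ∀ s, HasDerivAt ψ (-(m / 3 * Real.exp (-s / 3))) s := by
    intro s
    refine ((((hasDerivAt_id s).neg).div_const 3).exp.const_mul m).congr_deriv ?_
    simp only [Pi.neg_apply, id]
    ring
  have hψa : StrictAnti ψ := fun a b hab => by
    simp only [hψ]
    gcongr
  have hψm : Measurable ψ := by fun_prop
  have himg : ψ '' Icc (-L) (2 * L) = Icc l r := by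
    apply subset_antisymm
    · rintro _ ⟨s, hs, rfl⟩
      rw [← hψl, ← hψr]
      exact ⟨hψa.antitone hs.2, hψa.antitone hs.1⟩
    · have := intermediate_value_Icc' (by linarith : -L ≤ 2 * L)
        (fun s _ => (hψd s).continuousAt.continuousWithinAt)
      rwa [hψl, hψr] at this
  have hψmem : ∀ s ∈ Icc (-L) (2 * L), ψ s ∈ Icc l r := fun s hs => himg ▸ mem_image_of_mem ψ hs
  set T : ℝ × ℝ × ℝ → ℝ × ℝ × ℝ := fun p => (ψ p.1, ψ p.2.1, ψ p.2.2) with hT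
  have hTm : Measurable T := by fun_prop
  have hP : MeasurableSet {p : ℝ × ℝ × ℝ | p.1 ∈ Icc l r ∧ p.2.1 ∈ Icc l r ∧ p.2.2 ∈ Icc l r ∧
      p.1 * p.2.1 * p.2.2 = l * r ^ 2} :=
    (measurable_fst measurableSet_Icc).inter
      ((measurable_snd.fst measurableSet_Icc).inter
        ((measurable_snd.snd measurableSet_Icc).inter
          (measurableSet_eq_fun (by fun_prop) measurable_const)))
  refine ⟨ENNReal.ofReal (m / 3) • κ.map T, fun φ hφ => ?_, ?_⟩
  · rw [lintegral_smul_measure, lintegral_map (by fun_prop) hTm]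
    have h := hκ (fun s => φ (ψ s)) (by fun_prop)
    simp only [hT]
    rw [h, smul_eq_mul, ← lintegral_const_mul _ (by fun_prop), ← himg,
      lintegral_image_eq_lintegral_abs_deriv_mul measurableSet_Icc
        (fun s _ => (hψd s).hasDerivWithinAt) hψa.injective.injOn]
    refine lintegral_congr fun s => ?_
    rw [abs_neg, abs_of_nonneg (by positivity), ENNReal.ofReal_mul (by positivity), mul_assoc]
  · refine Measure.ae_smul_measure ?_ _
    rw [ae_map_iff hTm.aemeasurable hP]
    filter_upwards [hκs] with p hp
    obtain ⟨h1, h2, h3, h4⟩ := hp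
    refine ⟨hψmem _ h1, hψmem _ h2, hψmem _ h3, ?_⟩
    have e : T p = (ψ p.1, ψ p.2.1, ψ p.2.2) := rfl
    rw [e, ← hm3]
    simp only [hψ]
    have : Real.exp (-p.1 / 3) * Real.exp (-p.2.1 / 3) * Real.exp (-p.2.2 / 3) = 1 := by
      rw [← Real.exp_add, ← Real.exp_add, Real.exp_eq_one_iff]
      linarith
    calc _ = m ^ 3 * (Real.exp (-p.1 / 3) * Real.exp (-p.2.1 / 3) * Real.exp (-p.2.2 / 3)) := by
          ring
      _ = m ^ 3 := by rw [this, mul_one]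

lemma isClosed_onSupport : IsClosed {p : ℝ × ℝ × ℝ | OnSupport p.1 p.2.1 p.2.2} := by
  have h1 : IsClosed ((fun a : ℝ => (a, 1 - 2 * a, 1 - 2 * a)) '' Icc 0 l) :=
    (isCompact_Icc.image (by fun_prop)).isClosed
  have h2 : IsClosed ((fun a : ℝ => (1 - 2 * a, a, 1 - 2 * a)) '' Icc 0 l) :=
    (isCompact_Icc.image (by fun_prop)).isClosed
  have h3 : IsClosed ((fun a : ℝ => (1 - 2 * a, 1 - 2 * a, a)) '' Icc 0 l) :=
    (isCompact_Icc.image (by fun_prop)).isClosed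
  have h4 : IsClosed {p : ℝ × ℝ × ℝ | p.1 ∈ Icc l r ∧ p.2.1 ∈ Icc l r ∧ p.2.2 ∈ Icc l r ∧
      p.1 * p.2.1 * p.2.2 = l * r ^ 2} :=
    (isClosed_Icc.preimage continuous_fst).inter
      ((isClosed_Icc.preimage continuous_snd.fst).inter
        ((isClosed_Icc.preimage continuous_snd.snd).inter
          (isClosed_eq (by fun_prop) continuous_const)))
  convert ((h1.union h2).union h3).union h4 using 1
  ext ⟨x, y, z⟩
  simp only [OnSupport, mem_ofPred_eq, mem_union, mem_image, Prod.mk.injEq]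
  refine or_congr ⟨?_, ?_⟩ Iff.rfl
  · rintro ⟨a, ha, ⟨rfl, rfl, rfl⟩ | ⟨rfl, rfl, rfl⟩ | ⟨rfl, rfl, rfl⟩⟩
    · exact Or.inl (Or.inl ⟨_, ha, rfl, rfl, rfl⟩)
    · exact Or.inl (Or.inr ⟨_, ha, rfl, rfl, rfl⟩)
    · exact Or.inr ⟨_, ha, rfl, rfl, rfl⟩
  · rintro ((⟨a, ha, rfl, rfl, rfl⟩ | ⟨a, ha, rfl, rfl, rfl⟩) | ⟨a, ha, rfl, rfl, rfl⟩)
    · exact ⟨_, ha, Or.inl ⟨rfl, rfl, rfl⟩⟩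
    · exact ⟨_, ha, Or.inr (Or.inl ⟨rfl, rfl, rfl⟩)⟩
    · exact ⟨_, ha, Or.inr (Or.inr ⟨rfl, rfl, rfl⟩)⟩

lemma OnSupport.fst_mem {x y z : ℝ} (h : OnSupport x y z) : x ∈ Icc (0 : ℝ) 1 := by
  have hl := l_lt_sixth
  have hr := r_lt_one
  have hl0 := l_pos
  rcases h with ⟨a, ⟨h1, h2⟩, ⟨rfl, -, -⟩ | ⟨rfl, -, -⟩ | ⟨rfl, -, -⟩⟩ | ⟨h1, -⟩
  · exact ⟨by linarith, by linarith⟩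
  · exact ⟨by linarith, by linarith⟩
  · exact ⟨by linarith, by linarith⟩
  · exact ⟨by linarith [h1.1], by linarith [h1.2]⟩

/-- A measure on the support, the sum of whose three marginals is Lebesgue measure on `[0, 1]`. -/
lemma exists_base_measure :
    ∃ κ : Measure (ℝ × ℝ × ℝ),
      (∀ φ : ℝ → ENNReal, Measurable φ → ∫⁻ p, (φ p.1 + φ p.2.1 + φ p.2.2) ∂κ
        = ∫⁻ x in Icc 0 1, φ x) ∧
      ∀ᵐ p ∂κ, OnSupport p.1 p.2.1 p.2.2 := by
  obtain ⟨κ, hκ, hκs⟩ := exists_center_measure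
  have hTm : Measurable fun a : ℝ => (a, 1 - 2 * a, 1 - 2 * a) := by fun_prop
  -- A single arm suffices: 1-2a occurs twice and a ↦ 1-2a has Jacobian 2, so Lebesgue measure on
  -- [r, 1] appears with weight one.
  refine ⟨κ + (volume.restrict (Icc 0 l)).map fun a : ℝ => (a, 1 - 2 * a, 1 - 2 * a),
    fun φ hφ => ?_, ?_⟩
  · have harm : ∫⁻ x in Icc r 1, φ x = ∫⁻ a in Icc 0 l, 2 * φ (1 - 2 * a) := by
      have := lintegral_image_eq_lintegral_abs_deriv_mul (s := Icc 0 l)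
        (f := fun a : ℝ => 1 - 2 * a) (f' := fun _ => -(2 * 1)) measurableSet_Icc
        (fun x _ => (((hasDerivAt_id x).const_mul (2 : ℝ)).const_sub 1).hasDerivWithinAt)
        (fun a _ b _ h => by simpa using h) φ
      have himg : (fun a : ℝ => 1 - 2 * a) '' Icc 0 l = Icc r 1 := by
        rw [show (fun a : ℝ => 1 - 2 * a) = (fun b => 1 - b) ∘ fun a => 2 * a from rfl, image_comp,
          image_mul_left_Icc zero_le_two l_pos.le, image_const_sub_Icc, r_eq]
        simp
      rw [himg] at this
      simpa using this
    rw [lintegral_add_measure, hκ φ hφ, lintegral_map (by fun_prop) hTm,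
      lintegral_congr fun a => show φ a + φ (1 - 2 * a) + φ (1 - 2 * a) = φ a + 2 * φ (1 - 2 * a) by
        ring, lintegral_add_left hφ, ← harm, ← Ico_union_Icc_eq_Icc l_pos.le (by linarith
        [l_lt_sixth] : l ≤ 1), ← Ico_union_Icc_eq_Icc l_lt_r.le r_lt_one.le,
      lintegral_union (measurableSet_Ico.union measurableSet_Icc),
      lintegral_union measurableSet_Icc, Measure.restrict_congr_set Ico_ae_eq_Icc,
      Measure.restrict_congr_set Ico_ae_eq_Icc]
    · ring
    · exact Set.disjoint_left.2 fun x h h' => absurd h.2 (not_lt.2 h'.1)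
    · refine Set.disjoint_left.2 fun x h h' => ?_
      rcases h' with h' | h'
      · exact absurd h.2 (not_lt.2 h'.1)
      · exact absurd h.2 (not_lt.2 (l_lt_r.le.trans h'.1))
  · rw [ae_add_measure_iff]
    constructor
    · filter_upwards [hκs] with p hp using Or.inr hp
    · rw [ae_map_iff hTm.aemeasurable isClosed_onSupport.measurableSet]
      filter_upwards [ae_restrict_mem measurableSet_Icc] with a ha
      exact Or.inl ⟨a, ha, Or.inl ⟨rfl, rfl, rfl⟩⟩

/-- Three uniformly distributed variables on a space with measure `π` whose joint values lie on the
support of the optimal plan. -/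
structure IsOptimalCoupling {Ω : Type*} [MeasurableSpace Ω] (π : Measure Ω)
    (X Y Z : Ω → unitInterval) : Prop where
  fst : MeasurePreserving X π volume
  snd : MeasurePreserving Y π volume
  thd : MeasurePreserving Z π volume
  onSupport : ∀ᵐ ω ∂π, OnSupport (X ω) (Y ω) (Z ω)

/-- Summing the three cyclic rotations of the base measure makes each marginal equal to the sum of
its three marginals. -/
lemma exists_isOptimalCoupling :
    ∃ (π : Measure (unitInterval × unitInterval × unitInterval)),
      IsOptimalCoupling π (fun p => p.1) (fun p => p.2.1) (fun p => p.2.2) := by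
  obtain ⟨κ, hκ, hκs⟩ := exists_base_measure
  set q : ℝ → unitInterval := projIcc 0 1 zero_le_one with hq
  have hqm : Measurable q := continuous_projIcc.measurable
  have hqc : ∀ x ∈ Icc (0 : ℝ) 1, (q x : ℝ) = x := fun x hx => by
    rw [hq, projIcc_of_mem zero_le_one hx]
  set T₀ : ℝ × ℝ × ℝ → unitInterval × unitInterval × unitInterval :=
    fun p => (q p.1, q p.2.1, q p.2.2) with hT₀
  set T₁ : ℝ × ℝ × ℝ → unitInterval × unitInterval × unitInterval :=
    fun p => (q p.2.1, q p.2.2, q p.1) with hT₁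
  set T₂ : ℝ × ℝ × ℝ → unitInterval × unitInterval × unitInterval :=
    fun p => (q p.2.2, q p.1, q p.2.1) with hT₂
  have h₀ : Measurable T₀ := by fun_prop
  have h₁ : Measurable T₁ := by fun_prop
  have h₂ : Measurable T₂ := by fun_prop
  have hmarg : ∀ φ : unitInterval → ENNReal, Measurable φ →
      ∫⁻ p, (φ (q p.1) + φ (q p.2.1) + φ (q p.2.2)) ∂κ = ∫⁻ x, φ x := by
    intro φ hφ
    rw [hκ (fun x => φ (q x)) (by fun_prop),
      ← unitInterval.measurePreserving_coe.lintegral_comp (by fun_prop)]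
    refine lintegral_congr fun x => ?_
    rw [hq, projIcc_val]
  have hmap : ∀ F : unitInterval × unitInterval × unitInterval → ENNReal, Measurable F →
      ∫⁻ p, F p ∂(κ.map T₀ + κ.map T₁ + κ.map T₂) = ∫⁻ p, (F (T₀ p) + F (T₁ p) + F (T₂ p)) ∂κ := by
    intro F hF
    rw [lintegral_add_measure, lintegral_add_measure, lintegral_map hF h₀, lintegral_map hF h₁,
      lintegral_map hF h₂, lintegral_add_left (by fun_prop), lintegral_add_left (by fun_prop)]
  have hpres : ∀ X : unitInterval × unitInterval × unitInterval → unitInterval, Measurable X →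
      (∀ φ : unitInterval → ENNReal, ∀ p, φ (X (T₀ p)) + φ (X (T₁ p)) + φ (X (T₂ p))
        = φ (q p.1) + φ (q p.2.1) + φ (q p.2.2)) →
      MeasurePreserving X (κ.map T₀ + κ.map T₁ + κ.map T₂) volume := by
    intro X hX h
    refine ⟨hX, Measure.ext_of_lintegral _ fun φ hφ => ?_⟩
    rw [lintegral_map hφ hX, hmap (fun p => φ (X p)) (hφ.comp hX), lintegral_congr (h φ), hmarg φ hφ]
  refine ⟨κ.map T₀ + κ.map T₁ + κ.map T₂, hpres _ (by fun_prop) fun φ p => rfl,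
    hpres _ (by fun_prop) fun φ p => ?_, hpres _ (by fun_prop) fun φ p => ?_, ?_⟩
  · simp only [hT₀, hT₁, hT₂]; ring
  · simp only [hT₀, hT₁, hT₂]; ring
  · have hP : MeasurableSet {p : unitInterval × unitInterval × unitInterval |
        OnSupport p.1 p.2.1 p.2.2} :=
      (isClosed_onSupport.preimage (f := fun p : unitInterval × unitInterval × unitInterval =>
        ((p.1 : ℝ), (p.2.1 : ℝ), (p.2.2 : ℝ))) (by fun_prop)).measurableSet
    rw [ae_add_measure_iff, ae_add_measure_iff, ae_map_iff h₀.aemeasurable hP,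
      ae_map_iff h₁.aemeasurable hP, ae_map_iff h₂.aemeasurable hP]
    have key : ∀ᵐ p ∂κ, OnSupport (q p.1) (q p.2.1) (q p.2.2) := by
      filter_upwards [hκs] with p hp
      rwa [hqc _ hp.fst_mem, hqc _ hp.rotate.fst_mem, hqc _ hp.rotate.rotate.fst_mem]
    exact ⟨⟨key, key.mono fun p hp => hp.rotate⟩, key.mono fun p hp => hp.rotate.rotate⟩

/-! ### Integration against an optimal coupling -/

section Coupling

variable {Ω : Type*} [MeasurableSpace Ω] {π : Measure Ω} {X Y Z : Ω → unitInterval} {C k : ℝ → ℝ}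

lemma IsOptimalCoupling.rotate (h : IsOptimalCoupling π X Y Z) : IsOptimalCoupling π Y Z X :=
  ⟨h.snd, h.thd, h.fst, h.onSupport.mono fun _ hω => hω.rotate⟩

lemma integrable_of_continuous {f : unitInterval → ℝ} (hf : Continuous f) : Integrable f volume :=
  hf.integrable_of_hasCompactSupport (HasCompactSupport.of_compactSpace f)

lemma integral_comp_measurePreserving {X : Ω → unitInterval}
    (h : MeasurePreserving X π volume) {f : unitInterval → ℝ} (hf : Integrable f volume) :
    ∫ ω, f (X ω) ∂π = ∫ x, f x := by
  rw [← h.map_eq]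
  exact (integral_map h.measurable.aemeasurable (h.map_eq ▸ hf.aestronglyMeasurable)).symm

lemma IsOptimalCoupling.dualValue_eq (h : IsOptimalCoupling π X Y Z)
    {a b c : unitInterval → ℝ} (ha : Integrable a volume) (hb : Integrable b volume)
    (hc : Integrable c volume) :
    dualValue volume volume volume a b c = ∫ ω, (a (X ω) + b (Y ω) + c (Z ω)) ∂π := by
  have ha' : Integrable (fun ω => a (X ω)) π := h.fst.integrable_comp_of_integrable ha
  have hb' : Integrable (fun ω => b (Y ω)) π := h.snd.integrable_comp_of_integrable hb
  have hc' : Integrable (fun ω => c (Z ω)) π := h.thd.integrable_comp_of_integrable hc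
  rw [dualValue, ← integral_comp_measurePreserving h.fst ha,
    ← integral_comp_measurePreserving h.snd hb,
    ← integral_comp_measurePreserving h.thd hc]
  rw [← integral_add ha' hb']
  exact (integral_add (ha'.add hb') hc').symm

/-- The potential as a function on `unitInterval`. -/
noncomputable def unitPotential (k : ℝ → ℝ) (x : unitInterval) : ℝ := potential k x

lemma continuous_unitPotential (hk : Continuous k) : Continuous (unitPotential k) :=
  (continuous_potential hk).comp continuous_subtype_val

lemma integrable_unitPotential (hk : Continuous k) : Integrable (unitPotential k) volume :=
  integrable_of_continuous (continuous_unitPotential hk)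

lemma dualValue_add_const {a b c : unitInterval → ℝ} (ha : Integrable a volume)
    (hb : Integrable b volume) (hc : Integrable c volume) (s t u : ℝ) :
    dualValue volume volume volume (fun x => a x + s) (fun x => b x + t) (fun x => c x + u)
      = dualValue volume volume volume a b c + (s + t + u) := by
  rw [dualValue, dualValue, integral_add ha (integrable_const s),
    integral_add hb (integrable_const t), integral_add hc (integrable_const u)]
  simp only [integral_const, probReal_univ, one_smul]
  ring

lemma IsOptimalCoupling.ae_eq_cost (hk : Continuous k) (hC : ∀ t, HasDerivAt C (k t) t)
    (h : IsOptimalCoupling π X Y Z) :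
    ∀ᵐ ω ∂π, unitPotential k (X ω) + unitPotential k (Y ω) + (unitPotential k (Z ω)
      + (C 0 - 2 * potential k 1)) = C (X ω * Y ω * Z ω) := by
  filter_upwards [h.onSupport] with ω hω
  have := hω.potential_add_eq hk hC
  simp only [unitPotential]
  linarith

end Coupling

/-- Every potential whose increments are bounded by those of `t ↦ C(t λ(x))` is a translate of
`potential k`. -/
lemma eq_potential_add_const {C k : ℝ → ℝ} (hk : Continuous k) (hC : ∀ t, HasDerivAt C (k t) t)
    {F : ℝ → ℝ} (hF : ∀ x ∈ Icc (0 : ℝ) 1, ∀ t ∈ Icc (0 : ℝ) 1,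
      F t - F x ≤ C (t * lam x) - C (x * lam x)) :
    ∀ x ∈ Icc (0 : ℝ) 1, F x = potential k x + F 0 := by
  have hd : ∀ x ∈ Icc (0 : ℝ) 1, HasDerivWithinAt F (lam x * k (x * lam x)) (Icc 0 1) x := by
    intro x hx
    rw [hasDerivWithinAt_iff_isLittleO]
    have hu : (fun t => C (t * lam x) - C (x * lam x) - (t - x) • (lam x * k (x * lam x)))
        =o[nhdsWithin x (Icc 0 1)] fun t => t - x := by
      have h1 : HasDerivAt (fun t : ℝ => C (t * lam x)) (lam x * k (x * lam x)) x :=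
        ((hC _).comp x ((hasDerivAt_id x).mul_const (lam x))).congr_deriv (by simp; ring)
      exact hasDerivWithinAt_iff_isLittleO.1 h1.hasDerivWithinAt
    -- Exchanging x and t in the hypothesis bounds F t - F x from below with λ(t) in place of λ(x).
    -- As λ is only known to be continuous, strict differentiability of C is used to find the
    -- derivative of this bound.
    have hv : (fun t => C (t * lam t) - C (x * lam t) - (t - x) • (lam x * k (x * lam x)))
        =o[nhdsWithin x (Icc 0 1)] fun t => t - x := by
      have hs : HasStrictDerivAt C (k (x * lam x)) (x * lam x) :=
        hasStrictDerivAt_of_hasDerivAt_of_continuousAt (Filter.Eventually.of_forall hC)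
          hk.continuousAt
      have hlam := continuous_lam
      have ht : Filter.Tendsto (fun t => (t * lam t, x * lam t)) (nhdsWithin x (Icc 0 1))
          (nhds (x * lam x, x * lam x)) :=
        ((by fun_prop : Continuous fun t => (t * lam t, x * lam t)).tendsto x).mono_left
          nhdsWithin_le_nhds
      have h1 := (hs.hasStrictFDerivAt.isLittleO.comp_tendsto ht)
      have hb : (fun t => t * lam t - x * lam t) =O[nhdsWithin x (Icc 0 1)] fun t => t - x := by
        refine Asymptotics.IsBigO.of_bound 1 ?_
        filter_upwards [self_mem_nhdsWithin] with t ht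
        rw [← sub_mul, norm_mul, one_mul, Real.norm_of_nonneg (lam_nonneg ht)]
        exact mul_le_of_le_one_right (norm_nonneg _) (lam_le_one ht)
      have h2 := h1.trans_isBigO hb
      have h3 : (fun t => (t - x) * ((lam t - lam x) * k (x * lam x)))
          =o[nhdsWithin x (Icc 0 1)] fun t => (t - x) * 1 := by
        refine (Asymptotics.isBigO_refl _ _).mul_isLittleO ((Asymptotics.isLittleO_one_iff ℝ).2 ?_)
        have : Filter.Tendsto (fun t => (lam t - lam x) * k (x * lam x)) (nhds x)
            (nhds ((lam x - lam x) * k (x * lam x))) :=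
          (by fun_prop : Continuous fun t => (lam t - lam x) * k (x * lam x)).tendsto x
        rw [sub_self, zero_mul] at this
        exact this.mono_left nhdsWithin_le_nhds
      simp only [mul_one] at h3
      refine (h2.add h3).congr_left fun t => ?_
      simp
      ring
    refine Asymptotics.IsBigO.trans_isLittleO (Asymptotics.IsBigO.of_bound 1 ?_)
      (hu.norm_left.add hv.norm_left)
    filter_upwards [self_mem_nhdsWithin] with t ht
    have h1 := hF x hx t ht
    have h2 := hF t ht x hx
    rw [one_mul]
    refine le_trans ?_ (le_abs_self _)
    rw [Real.norm_eq_abs, Real.norm_eq_abs, Real.norm_eq_abs, abs_le]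
    constructor
    · have := neg_abs_le (C (t * lam t) - C (x * lam t) - (t - x) • (lam x * k (x * lam x)))
      have := abs_nonneg (C (t * lam x) - C (x * lam x) - (t - x) • (lam x * k (x * lam x)))
      linarith
    · have := le_abs_self (C (t * lam x) - C (x * lam x) - (t - x) • (lam x * k (x * lam x)))
      have := abs_nonneg (C (t * lam t) - C (x * lam t) - (t - x) • (lam x * k (x * lam x)))
      linarith
  have hd' : ∀ x ∈ Icc (0 : ℝ) 1,
      HasDerivWithinAt (fun x => F x - potential k x) 0 (Icc 0 1) x := fun x hx =>
    ((hd x hx).sub (hasDerivAt_potential hk x).hasDerivWithinAt).congr_deriv (sub_self _)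
  intro x hx
  have := constant_of_derivWithin_zero (f := fun x => F x - potential k x)
    (fun x hx => (hd' x hx).differentiableWithinAt)
    (fun x hx => (hd' x (Ico_subset_Icc_self hx)).derivWithin
      (uniqueDiffOn_Icc zero_lt_one x (Ico_subset_Icc_self hx))) x hx
  simp only [potential_zero, sub_zero] at this
  linarith

/-- A nonempty relatively open subset of [0, 1] meets (0, 1) in a nonempty open set, which has
positive measure. -/
lemma eq_univ_of_volume_compl_eq_zero {J : Set unitInterval} (hJ : IsClosed J)
    (h : volume Jᶜ = 0) : J = univ := by
  by_contra hne
  obtain ⟨x, hx⟩ := nonempty_compl.2 hne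
  obtain ⟨U, hU, hUJ⟩ := isOpen_induced_iff.1 hJ.isOpen_compl
  have hxU : (x : ℝ) ∈ U := by
    have : x ∈ Subtype.val ⁻¹' U := hUJ ▸ hx
    exact this
  have hxc : (x : ℝ) ∈ closure (Ioo (0 : ℝ) 1) := by
    rw [closure_Ioo zero_ne_one]; exact x.2
  have hpos : 0 < volume (U ∩ Ioo (0 : ℝ) 1) :=
    (hU.inter isOpen_Ioo).measure_pos volume (mem_closure_iff.1 hxc U hU hxU)
  have hsub : U ∩ Ioo (0 : ℝ) 1 ⊆ Subtype.val '' Jᶜ := by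
    rintro y ⟨hyU, hy⟩
    refine ⟨⟨y, Ioo_subset_Icc_self hy⟩, ?_, rfl⟩
    rw [← hUJ]
    exact hyU
  rw [unitInterval.volume_apply] at h
  exact absurd (measure_mono_null hsub h) hpos.ne'

/-! ### Conjugate potentials and tightness of optimal triples -/

section Uniqueness

variable {Ω : Type*} [MeasurableSpace Ω] {π : Measure Ω} {X Y Z : Ω → unitInterval} {C k : ℝ → ℝ}
  {f g h : unitInterval → ℝ}

/-- Continuous potentials that are tight almost everywhere are translates of `unitPotential`. -/
lemma IsOptimalCoupling.exists_eq_add_const (hπ : IsOptimalCoupling π X Y Z) (hk : Continuous k)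
    (hC : ∀ t, HasDerivAt C (k t) t) (hf : Continuous f) (hg : Continuous g) (hh : Continuous h)
    (hle : ∀ x y z : unitInterval, f x + g y + h z ≤ C (x * y * z))
    (heq : ∀ᵐ ω ∂π, f (X ω) + g (Y ω) + h (Z ω) = C (X ω * Y ω * Z ω)) :
    ∃ c, ∀ x, f x = unitPotential k x + c := by
  have hCc : Continuous C := continuous_iff_continuousAt.2 fun t => (hC t).continuousAt
  have hlam := continuous_lam
  -- The contact set is compact, so its projection is closed. The projection also has full measure,
  -- hence is all of [0, 1]: every x, not just almost every x, has a tight partner (y, z) with yz =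
  -- λ(x).
  set K : Set (unitInterval × unitInterval × unitInterval) :=
    {p | (p.2.1 : ℝ) * p.2.2 = lam p.1 ∧ f p.1 + g p.2.1 + h p.2.2 = C (p.1 * p.2.1 * p.2.2)}
  have hK : IsClosed K :=
    (isClosed_eq (by fun_prop) (by fun_prop)).inter (isClosed_eq (by fun_prop) (by fun_prop))
  have hJ : IsClosed (Prod.fst '' K) := (hK.isCompact.image continuous_fst).isClosed
  have hnull : volume (Prod.fst '' K)ᶜ = 0 := by
    rw [← hπ.fst.measure_preimage hJ.isOpen_compl.measurableSet.nullMeasurableSet]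
    have : ∀ᵐ ω ∂π, ω ∉ X ⁻¹' (Prod.fst '' K)ᶜ := by
      filter_upwards [heq, hπ.onSupport] with ω h1 h2
      exact fun hn => hn ⟨(X ω, Y ω, Z ω), ⟨h2.mul_eq_lam, h1⟩, rfl⟩
    exact measure_eq_zero_iff_ae_notMem.2 this
  have huniv := eq_univ_of_volume_compl_eq_zero hJ hnull
  have hinc : ∀ x t : unitInterval, f t - f x ≤ C (t * lam x) - C (x * lam x) := by
    intro x t
    obtain ⟨p, ⟨h1, h2⟩, rfl⟩ : x ∈ Prod.fst '' K := huniv ▸ mem_univ x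
    have h3 := hle t p.2.1 p.2.2
    rw [mul_assoc, h1] at h2 h3
    linarith
  have := eq_potential_add_const hk hC (F := fun x => f (projIcc 0 1 zero_le_one x))
    fun x hx t ht => by
      simp only [projIcc_of_mem zero_le_one hx, projIcc_of_mem zero_le_one ht]
      exact hinc ⟨x, hx⟩ ⟨t, ht⟩
  refine ⟨f (projIcc 0 1 zero_le_one 0), fun x => ?_⟩
  have h1 := this x x.2
  simp only [projIcc_val] at h1
  exact h1

/-- The conjugate of a pair of potentials. -/
noncomputable def costTransform (C : ℝ → ℝ) (g h : unitInterval → ℝ) (x : unitInterval) : ℝ :=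
  ⨅ p : unitInterval × unitInterval, (C (x * p.1 * p.2) - g p.1 - h p.2)

lemma bddBelow_costTransform
    (hle : ∀ x y z : unitInterval, f x + g y + h z ≤ C (x * y * z)) (x : unitInterval) :
    BddBelow (range fun p : unitInterval × unitInterval => C (x * p.1 * p.2) - g p.1 - h p.2) := by
  refine ⟨f x, ?_⟩
  rintro _ ⟨p, rfl⟩
  have := hle x p.1 p.2
  simp only
  linarith

lemma le_costTransform (hle : ∀ x y z : unitInterval, f x + g y + h z ≤ C (x * y * z))
    (x : unitInterval) : f x ≤ costTransform C g h x :=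
  le_ciInf fun p => by linarith [hle x p.1 p.2]

lemma costTransform_add_le (hle : ∀ x y z : unitInterval, f x + g y + h z ≤ C (x * y * z))
    (x y z : unitInterval) : costTransform C g h x + g y + h z ≤ C (x * y * z) := by
  have := ciInf_le (bddBelow_costTransform hle x) (y, z)
  simp only at this
  unfold costTransform
  linarith

/-- An infimum of functions of x with a common Lipschitz constant: the argument of C moves by at
most |x - x'|, and M bounds |C'| on [0, 1]. -/
lemma continuous_costTransform (hk : Continuous k) (hC : ∀ t, HasDerivAt C (k t) t)
    (hle : ∀ x y z : unitInterval, f x + g y + h z ≤ C (x * y * z)) :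
    Continuous (costTransform C g h) := by
  obtain ⟨M, hM⟩ := isCompact_Icc.exists_bound_of_continuousOn (hk.continuousOn (s := Icc 0 1))
  have hM0 : 0 ≤ M := (norm_nonneg _).trans (hM 0 (left_mem_Icc.2 zero_le_one))
  refine (LipschitzWith.of_le_add_mul M.toNNReal fun x x' => ?_).continuous
  rw [Real.coe_toNNReal M hM0, ← sub_le_iff_le_add]
  refine le_ciInf fun p => ?_
  have h1 := costTransform_add_le hle x p.1 p.2
  have h2 := (convex_Icc (0 : ℝ) 1).norm_image_sub_le_of_norm_hasDerivWithin_le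
    (fun t _ => (hC t).hasDerivWithinAt) hM (x' * p.1 * p.2).2 (x * p.1 * p.2).2
  have h3 : ‖((x * p.1 * p.2 : unitInterval) : ℝ) - (x' * p.1 * p.2 : unitInterval)‖
      ≤ dist x x' := by
    push_cast
    rw [show (x : ℝ) * p.1 * p.2 - x' * p.1 * p.2 = (x - x') * ((p.1 : ℝ) * p.2) by ring,
      norm_mul, Real.norm_of_nonneg (mul_nonneg p.1.2.1 p.2.2.1), Subtype.dist_eq,
      Real.dist_eq, Real.norm_eq_abs]
    exact mul_le_of_le_one_right (abs_nonneg _) (mul_le_one₀ p.1.2.2 p.2.2.1 p.2.2.2)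
  have h4 := (le_abs_self _).trans (h2.trans (mul_le_mul_of_nonneg_left h3 hM0))
  push_cast at h4
  linarith

lemma IsDualSolutionXYZ.rotate (hs : IsDualSolutionXYZ C f g h) : IsDualSolutionXYZ C g h f := by
  obtain ⟨⟨hf, hg, hh, hle⟩, hmax⟩ := hs
  refine ⟨⟨hg, hh, hf, fun x y z => ?_⟩, fun f' g' h' ⟨hf', hg', hh', hle'⟩ => ?_⟩
  · have := hle z x y
    simp only at this ⊢
    rw [show (x : ℝ) * y * z = z * x * y by ring]
    linarith
  · have := hmax h' f' g' ⟨hh', hf', hg', fun x y z => by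
      have := hle' y z x
      simp only at this ⊢
      rw [show (x : ℝ) * y * z = y * z * x by ring]
      linarith⟩
    simp only [dualValue] at this ⊢
    linarith

/-- The conjugate dominates f and keeps the triple feasible. Maximality forbids a larger integral,
so the two agree almost everywhere. -/
lemma IsDualSolutionXYZ.exists_continuous (hk : Continuous k) (hC : ∀ t, HasDerivAt C (k t) t)
    (hs : IsDualSolutionXYZ C f g h) :
    ∃ f₁, Continuous f₁ ∧ (∀ x, f x ≤ f₁ x) ∧ (∀ᵐ x, f x = f₁ x) ∧ IsDualSolutionXYZ C f₁ g h := by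
  obtain ⟨⟨hf, hg, hh, hle⟩, hmax⟩ := hs
  have hcont := continuous_costTransform hk hC hle
  have hint := integrable_of_continuous hcont
  have hfeas : IsDualFeasible volume volume volume
      (fun x y z : unitInterval => C ((x : ℝ) * (y : ℝ) * (z : ℝ))) (costTransform C g h) g h :=
    ⟨hint, hg, hh, costTransform_add_le hle⟩
  have h1 := integral_mono hf hint (le_costTransform hle)
  have h2 := hmax _ _ _ hfeas
  have h3 : ∫ x, f x = ∫ x, costTransform C g h x := by
    simp only [dualValue] at h2
    linarith
  refine ⟨_, hcont, le_costTransform hle,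
    (integral_eq_iff_of_ae_le hf hint (.of_forall (le_costTransform hle))).1 h3, hfeas, ?_⟩
  intro f' g' h' hfeas'
  have := hmax f' g' h' hfeas'
  simp only [dualValue] at this ⊢
  linarith

/-- Weak duality: both values are integrals over π, and the translated potentials sum to the cost on
the support. Equal integrals of ordered functions force tightness π-almost everywhere. Only equality
on the support enters, not feasibility of the potentials. -/
lemma IsOptimalCoupling.dualValue_le (hπ : IsOptimalCoupling π X Y Z) (hk : Continuous k)
    (hC : ∀ t, HasDerivAt C (k t) t)
    (hs : IsDualFeasible volume volume volume
      (fun x y z : unitInterval => C ((x : ℝ) * (y : ℝ) * (z : ℝ))) f g h) :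
    dualValue volume volume volume f g h
        ≤ dualValue volume volume volume (unitPotential k) (unitPotential k) (unitPotential k)
          + (C 0 - 2 * potential k 1) ∧
      (dualValue volume volume volume f g h
        = dualValue volume volume volume (unitPotential k) (unitPotential k) (unitPotential k)
          + (C 0 - 2 * potential k 1) →
        ∀ᵐ ω ∂π, f (X ω) + g (Y ω) + h (Z ω) = C (X ω * Y ω * Z ω)) := by
  obtain ⟨hf, hg, hh, hle⟩ := hs
  have hP := integrable_unitPotential hk
  have hP' : Integrable (fun z => unitPotential k z + (C 0 - 2 * potential k 1)) volume :=
    hP.add (integrable_const _)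
  have e := dualValue_add_const hP hP hP 0 0 (C 0 - 2 * potential k 1)
  simp only [add_zero, zero_add] at e
  have hcost := hπ.ae_eq_cost hk hC
  have hi : ∀ {a b c : unitInterval → ℝ}, Integrable a volume → Integrable b volume →
      Integrable c volume → Integrable (fun ω => a (X ω) + b (Y ω) + c (Z ω)) π := fun ha hb hc =>
    ((hπ.fst.integrable_comp_of_integrable ha).add (hπ.snd.integrable_comp_of_integrable hb)).add
      (hπ.thd.integrable_comp_of_integrable hc)
  have hmono : (fun ω => f (X ω) + g (Y ω) + h (Z ω)) ≤ᵐ[π] fun ω => unitPotential k (X ω)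
      + unitPotential k (Y ω) + (unitPotential k (Z ω) + (C 0 - 2 * potential k 1)) := by
    filter_upwards [hcost] with ω hω
    rw [hω]
    exact hle _ _ _
  rw [← e, hπ.dualValue_eq hf hg hh, hπ.dualValue_eq hP hP hP']
  refine ⟨integral_mono_ae (hi hf hg hh) (hi hP hP hP') hmono, fun heq => ?_⟩
  filter_upwards [(integral_eq_iff_of_ae_le (hi hf hg hh) (hi hP hP hP') hmono).1 heq, hcost]
    with ω h1 h2
  rw [← h2]
  exact h1

end Uniqueness

/-! ### Characterization of the dual solutions -/

section Characterization

variable {C k : ℝ → ℝ} {f g h : unitInterval → ℝ}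

lemma isDualFeasible_unitPotential (hk : Continuous k) (hC : ∀ t, HasDerivAt C (k t) t)
    (hU : MonotoneOn (fun t => t * k t) (Icc 0 1)) {a b c : ℝ}
    (habc : a + b + c = C 0 - 2 * potential k 1) :
    IsDualFeasible volume volume volume
      (fun x y z : unitInterval => C ((x : ℝ) * (y : ℝ) * (z : ℝ)))
      (fun x => unitPotential k x + a) (fun x => unitPotential k x + b)
      (fun x => unitPotential k x + c) := by
  have hP := integrable_unitPotential hk
  refine ⟨hP.add (integrable_const _), hP.add (integrable_const _), hP.add (integrable_const _),
    fun x y z => ?_⟩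
  have := potential_add_le hk hC hU x.2 y.2 z.2
  simp only [unitPotential]
  linarith

lemma isDualSolutionXYZ_iff (hk : Continuous k) (hC : ∀ t, HasDerivAt C (k t) t)
    (hU : MonotoneOn (fun t => t * k t) (Icc 0 1)) :
    IsDualSolutionXYZ C f g h ↔ ∃ a b c : ℝ, a + b + c = C 0 - 2 * potential k 1 ∧
      (∀ x, f x ≤ unitPotential k x + a) ∧ (∀ y, g y ≤ unitPotential k y + b) ∧
      (∀ z, h z ≤ unitPotential k z + c) ∧ (∀ᵐ x, f x = unitPotential k x + a) ∧
      (∀ᵐ y, g y = unitPotential k y + b) ∧ (∀ᵐ z, h z = unitPotential k z + c) := by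
  obtain ⟨π, hπ⟩ := exists_isOptimalCoupling
  have hP := integrable_unitPotential hk
  constructor
  · intro hs
    -- Each function is conjugated in turn, a rotation bringing the next one to the first place; the
    -- triple remains optimal throughout.
    obtain ⟨f₁, hf₁, hff₁, hff₁', hs₁⟩ := hs.exists_continuous hk hC
    obtain ⟨g₁, hg₁, hgg₁, hgg₁', hs₂⟩ := hs₁.rotate.exists_continuous hk hC
    obtain ⟨h₁, hh₁, hhh₁, hhh₁', hs₃⟩ := hs₂.rotate.exists_continuous hk hC
    have hs₄ := hs₃.rotate
    have hval : dualValue volume volume volume f₁ g₁ h₁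
        = dualValue volume volume volume (unitPotential k) (unitPotential k) (unitPotential k)
          + (C 0 - 2 * potential k 1) := by
      refine le_antisymm (hπ.dualValue_le hk hC hs₄.1).1 ?_
      have h1 := hs₄.2 _ _ _ (isDualFeasible_unitPotential hk hC hU
        (show 0 + 0 + (C 0 - 2 * potential k 1) = _ by ring))
      rw [dualValue_add_const hP hP hP] at h1
      linarith
    have htight := (hπ.dualValue_le hk hC hs₄.1).2 hval
    obtain ⟨a, ha⟩ := hπ.exists_eq_add_const hk hC hf₁ hg₁ hh₁ hs₄.1.2.2.2 htight
    obtain ⟨b, hb⟩ := hπ.rotate.exists_eq_add_const hk hC hg₁ hh₁ hf₁ hs₄.rotate.1.2.2.2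
      (htight.mono fun ω hω => by
        rw [← show ((ω.1 : ℝ) * ω.2.1 * ω.2.2) = ω.2.1 * ω.2.2 * ω.1 by ring, ← hω]; ring)
    obtain ⟨c, hc⟩ := hπ.rotate.rotate.exists_eq_add_const hk hC hh₁ hf₁ hg₁
      hs₄.rotate.rotate.1.2.2.2
      (htight.mono fun ω hω => by
        rw [← show ((ω.1 : ℝ) * ω.2.1 * ω.2.2) = ω.2.2 * ω.1 * ω.2.1 by ring, ← hω]; ring)
    refine ⟨a, b, c, ?_, fun x => ha x ▸ hff₁ x, fun x => hb x ▸ hgg₁ x, fun x => hc x ▸ hhh₁ x,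
      hff₁'.mono fun x hx => ha x ▸ hx, hgg₁'.mono fun x hx => hb x ▸ hx,
      hhh₁'.mono fun x hx => hc x ▸ hx⟩
    rw [funext ha, funext hb, funext hc, dualValue_add_const hP hP hP] at hval
    linarith
  · rintro ⟨a, b, c, habc, hf, hg, hh, hf', hg', hh'⟩
    have hfeas := isDualFeasible_unitPotential hk hC hU habc
    refine ⟨⟨hfeas.1.congr (hf'.mono fun x hx => hx.symm),
      hfeas.2.1.congr (hg'.mono fun x hx => hx.symm),
      hfeas.2.2.1.congr (hh'.mono fun x hx => hx.symm),
      fun x y z => le_trans (add_le_add_three (hf x) (hg y) (hh z)) (hfeas.2.2.2 x y z)⟩, ?_⟩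
    intro f' g' h' hfeas'
    refine (hπ.dualValue_le hk hC hfeas').1.trans (le_of_eq ?_)
    rw [← habc, ← dualValue_add_const hP hP hP, dualValue, dualValue, integral_congr_ae hf',
      integral_congr_ae hg', integral_congr_ae hh']

/-- A `C¹` function on `[0, 1]` extends to a `C¹` function on the line. -/
lemma exists_hasDerivAt_extension (hC : ContDiffOn ℝ 1 C (Icc 0 1)) :
    ∃ C₁ k : ℝ → ℝ, Continuous k ∧ (∀ t, HasDerivAt C₁ (k t) t) ∧ EqOn C₁ C (Icc 0 1) ∧
      EqOn k (derivWithin C (Icc 0 1)) (Icc 0 1) := by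
  have hud : UniqueDiffOn ℝ (Icc (0 : ℝ) 1) := uniqueDiffOn_Icc zero_lt_one
  have hc : ContinuousOn (derivWithin C (Icc 0 1)) (Icc 0 1) :=
    hC.continuousOn_derivWithin hud le_rfl
  -- C' is continued by its end values and then integrated from 0.
  set k : ℝ → ℝ := IccExtend zero_le_one ((Icc (0 : ℝ) 1).domRestrict (derivWithin C (Icc 0 1)))
  have hk : Continuous k := hc.domRestrict.Icc_extend'
  have hkd : EqOn k (derivWithin C (Icc 0 1)) (Icc 0 1) := fun t ht =>
    IccExtend_of_mem zero_le_one _ ht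
  have hder : ∀ t, HasDerivAt (fun t => C 0 + ∫ s in (0 : ℝ)..t, k s) (k t) t := fun t =>
    (intervalIntegral.integral_hasDerivAt_right (hk.intervalIntegrable _ _)
      (hk.stronglyMeasurableAtFilter _ _) hk.continuousAt).const_add _
  refine ⟨_, k, hk, hder, fun x hx => ?_, hkd⟩
  have hd : ∀ t ∈ Icc (0 : ℝ) 1,
      HasDerivWithinAt (fun t => (C 0 + ∫ s in (0 : ℝ)..t, k s) - C t) 0 (Icc 0 1) t := by
    intro t ht
    refine ((hder t).hasDerivWithinAt.sub
      ((hC.differentiableOn one_ne_zero) t ht).hasDerivWithinAt).congr_deriv ?_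
    rw [hkd ht, sub_self]
  have := constant_of_derivWithin_zero (fun t ht => (hd t ht).differentiableWithinAt)
    (fun t ht => (hd t (Ico_subset_Icc_self ht)).derivWithin
      (hud t (Ico_subset_Icc_self ht))) x hx
  simp only [intervalIntegral.integral_same, add_zero, sub_self] at this
  exact sub_eq_zero.1 this

lemma fHat_eq_potential (hk : EqOn k (derivWithin C (Icc 0 1)) (Icc 0 1)) {s : ℝ}
    (hs : s ∈ Icc (0 : ℝ) 1) : fHat C s = potential k s := by
  refine intervalIntegral.integral_congr fun t ht => ?_
  rw [uIcc_of_le hs.1] at ht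
  exact congrArg (lam t * ·) (hk (mul_lam_mem ⟨ht.1, ht.2.trans hs.2⟩)).symm

end Characterization

end MultimarginalXYZ

theorem mainTheorem3 (C : ℝ → ℝ) (hC : ContDiffOn ℝ 1 C (Set.Icc 0 1))
    (hU : StrictMonoOn (fun t : ℝ => t * derivWithin C (Set.Icc 0 1) t) (Set.Icc 0 1)) :
    (∀ f g h : unitInterval → ℝ,
      MultimarginalXYZ.IsDualSolutionXYZ C f g h ↔
        ∃ Cf Cg Ch : ℝ,
          Cf + Cg + Ch = C 0 - 2 * ∫ t in (0 : ℝ)..1,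
            MultimarginalXYZ.lam t *
              derivWithin C (Set.Icc 0 1) (t * MultimarginalXYZ.lam t) ∧
          (∀ x : unitInterval, f x ≤ MultimarginalXYZ.fHat C x + Cf) ∧
          (∀ y : unitInterval, g y ≤ MultimarginalXYZ.fHat C y + Cg) ∧
          (∀ z : unitInterval, h z ≤ MultimarginalXYZ.fHat C z + Ch) ∧
          (∀ᵐ x : unitInterval, f x = MultimarginalXYZ.fHat C x + Cf) ∧
          (∀ᵐ y : unitInterval, g y = MultimarginalXYZ.fHat C y + Cg) ∧
          (∀ᵐ z : unitInterval, h z = MultimarginalXYZ.fHat C z + Ch)) ∧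
    (∀ f g h f' g' h' : unitInterval → ℝ,
      MultimarginalXYZ.IsDualSolutionXYZ C f g h →
      MultimarginalXYZ.IsDualSolutionXYZ C f' g' h' →
        ∃ a b c : ℝ, a + b + c = 0 ∧
          (∀ᵐ x : unitInterval, f' x = f x + a) ∧
          (∀ᵐ y : unitInterval, g' y = g y + b) ∧
          (∀ᵐ z : unitInterval, h' z = h z + c)) := by
  -- The products xyz and tλ(t) stay in [0, 1], so passing to the extension changes neither the cost
  -- nor the potentials.
  obtain ⟨C₁, k, hk, hder, hC₁, hkd⟩ := MultimarginalXYZ.exists_hasDerivAt_extension hC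
  have hU₁ : MonotoneOn (fun t => t * k t) (Icc 0 1) :=
    hU.monotoneOn.congr fun t ht => by simp only [hkd ht]
  have hcost : ∀ f g h : unitInterval → ℝ, MultimarginalXYZ.IsDualSolutionXYZ C f g h ↔
      MultimarginalXYZ.IsDualSolutionXYZ C₁ f g h := by
    intro f g h
    have : (fun x y z : unitInterval => C ((x : ℝ) * (y : ℝ) * (z : ℝ)))
        = fun x y z : unitInterval => C₁ ((x : ℝ) * (y : ℝ) * (z : ℝ)) := by
      funext x y z
      exact (hC₁ (x * y * z).2).symm
    rw [MultimarginalXYZ.IsDualSolutionXYZ, MultimarginalXYZ.IsDualSolutionXYZ, this]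
  have hpot : ∀ x : unitInterval,
      MultimarginalXYZ.fHat C x = MultimarginalXYZ.unitPotential k x := fun x =>
    MultimarginalXYZ.fHat_eq_potential hkd x.2
  have hone : ∫ t in (0 : ℝ)..1, MultimarginalXYZ.lam t *
      derivWithin C (Set.Icc 0 1) (t * MultimarginalXYZ.lam t)
        = MultimarginalXYZ.potential k 1 :=
    MultimarginalXYZ.fHat_eq_potential hkd (right_mem_Icc.2 zero_le_one)
  have hiff : ∀ f g h : unitInterval → ℝ, _ ↔ _ := fun f g h =>
    (hcost f g h).trans (MultimarginalXYZ.isDualSolutionXYZ_iff hk hder hU₁)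
  constructor
  · intro f g h
    simp only [hpot]
    rw [hone, ← hC₁ (left_mem_Icc.2 zero_le_one)]
    exact hiff f g h
  · intro f g h f' g' h' hs hs'
    obtain ⟨a, b, c, habc, -, -, -, hf, hg, hh⟩ := (hiff f g h).1 hs
    obtain ⟨a', b', c', habc', -, -, -, hf', hg', hh'⟩ := (hiff f' g' h').1 hs'
    refine ⟨a' - a, b' - b, c' - c, by linarith, ?_, ?_, ?_⟩
    · filter_upwards [hf, hf'] with x h1 h2
      linarith
    · filter_upwards [hg, hg'] with x h1 h2
      linarith
    · filter_upwards [hh, hh'] with x h1 h2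
      linarith
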